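/- Theorem 1.1 (Strichartz estimates on a periodic lattice). Let $d\ge 1$ be an integer. For a positive integer $M$ put $h=\pi/M$ and let $\mathbb T_h^d=h\mathbb Z^d/2\pi\mathbb Z^d$, a finite group of $(2M)^d$ points. For $f:\mathbb T_h^d\to\mathbb C$ let $\|f\|_{L^r_h}=\bigl(h^d\sum_{x\in\mathbb T_h^d}|f(x)|^r\bigr)^{1/r}$ if $1\le r<\infty$ and $\|f\|_{L^\infty_h}=\sup_{x\in\mathbb T_h^d}|f(x)|$. Let $\Delta_h$ be the discrete Laplacian $$(\Delta_h f)(x)=\sum_{j=1}^d\frac{f(x+he_j)+f(x-he_j)-2f(x)}{h^2},$$ and let $e^{it\Delta_h}$ be the exponential of the linear operator $it\Delta_h$. For $s\in\mathbb R$ let $\langle\nabla_h\rangle^s$ be the Fourier multiplier $$(\langle\nabla_h\rangle^s f)(x)=\frac1{(2\pi)^d}\sum_{k\in\{-M,\dots,M-1\}^d}(1+|k|^2)^{s/2}\Bigl(h^d\sum_{y\in\mathbb T_h^d}f(y)e^{-ik\cdot y}\Bigr)e^{ik\cdot x}.$$ Let $(q,r)$ be lattice-admissible, i.e. $2\le q,r\le\infty$,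 $\frac3q+\frac dr=\frac d2$ and $(q,r,d)\ne(2,\infty,3)$. Then for every $\varepsilon>0$ there is a constant $C>0$, depending only on $d$, $q$, $r$ and $\varepsilon$ (in particular independent of $h$), such that for every $h=\pi/M\in(0,1]$ and every $u:\mathbb T_h^d\to\mathbb C$, $$\|e^{it\Delta_h}u\|_{L^q_t([0,1];L^r_h)}\le C\,\|\langle\nabla_h\rangle^{\frac2q+\varepsilon}u\|_{L^2_h}.$$ -/

import Mathlib

open MeasureTheory
open scoped ENNReal

namespace PeriodicLattice

/-- The mesh size `h = π / M`. -/
noncomputable def mesh (M : ℕ) : ℝ := Real.pi / M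

/-- The periodic lattice `h ℤ^d / 2π ℤ^d` with `h = π / M`. Its `(2M)^d` points `x = h m` are
indexed by `m`, which is an integer vector modulo `2M` because `2π = 2M h`. -/
abbrev Lattice (M d : ℕ) : Type := Fin d → ZMod (2 * M)

/-- The `j`-th coordinate of a lattice point `x`, as a representative in `[0, 2π)` of a real number
modulo `2π`. -/
noncomputable def coord {M d : ℕ} (x : Lattice M d) (j : Fin d) : ℝ :=
  mesh M * ((x j).val : ℝ)

/-- The discrete Laplacian
`(Δ_h u)(x) = ∑_j (u (x + h e_j) + u (x - h e_j) - 2 u(x)) / h ^ 2`. -/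
noncomputable def laplacian (M d : ℕ) : (Lattice M d → ℂ) →ₗ[ℂ] (Lattice M d → ℂ) where
  toFun u x := ∑ j : Fin d,
    (u (x + Pi.single j 1) + u (x - Pi.single j 1) - 2 * u x) / ((mesh M : ℂ) ^ 2)
  map_add' u v := by
    funext x
    simp only [Pi.add_apply, ← Finset.sum_add_distrib]
    exact Finset.sum_congr rfl fun j _ => by ring
  map_smul' c u := by
    funext x
    simp only [Pi.smul_apply, smul_eq_mul, RingHom.id_apply, Finset.mul_sum]
    exact Finset.sum_congr rfl fun j _ => by ring

/-- The linear Schrödinger propagator `e^{i t Δ_h}`, the exponential of the operator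
`i t Δ_h` on the finite-dimensional space of functions on the lattice. -/
noncomputable def propagator (M d : ℕ) [NeZero M] (t : ℝ) :
    (Lattice M d → ℂ) →L[ℂ] (Lattice M d → ℂ) :=
  NormedSpace.exp ((Complex.I * (t : ℂ)) • (laplacian M d).toContinuousLinearMap)

/-- The frequencies `{-M, …, M - 1}^d`, i.e. the points of the dual lattice. -/
noncomputable def freqs (M d : ℕ) : Finset (Fin d → ℤ) :=
  Fintype.piFinset fun _ => Finset.Ico (-(M : ℤ)) (M : ℤ)

/-- The Euclidean product `k · x` (well defined modulo `2π`). -/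
noncomputable def pairing {M d : ℕ} (k : Fin d → ℤ) (x : Lattice M d) : ℝ :=
  ∑ j : Fin d, (k j : ℝ) * coord x j

/-- The Fourier transform `(F_h u)(k) = h^d ∑_x u(x) e^{-i k·x}`. -/
noncomputable def latticeFourier {M d : ℕ} [NeZero M] (u : Lattice M d → ℂ) (k : Fin d → ℤ) : ℂ :=
  (mesh M : ℂ) ^ d * ∑ x : Lattice M d, u x * Complex.exp (-(Complex.I * (pairing k x : ℂ)))

/-- The inverse Fourier transform `(F_h⁻¹ v)(x) = (2π)^{-d} ∑_k v(k) e^{i k·x}`. -/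
noncomputable def latticeFourierInv {M d : ℕ} (v : (Fin d → ℤ) → ℂ) (x : Lattice M d) : ℂ :=
  1 / (2 * (Real.pi : ℂ)) ^ d * ∑ k ∈ freqs M d, v k * Complex.exp (Complex.I * (pairing k x : ℂ))

/-- The Japanese bracket `⟨k⟩ = (1 + |k|^2)^{1/2}`. -/
noncomputable def bracket {d : ℕ} (k : Fin d → ℤ) : ℝ :=
  Real.sqrt (1 + ∑ j : Fin d, (k j : ℝ) ^ 2)

/-- The fractional derivative `⟨∇_h⟩^s`, the Fourier multiplier of symbol `⟨k⟩^s`. -/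
noncomputable def fracDeriv {M d : ℕ} [NeZero M] (s : ℝ) (u : Lattice M d → ℂ) :
    Lattice M d → ℂ :=
  latticeFourierInv fun k => ((bracket k ^ s : ℝ) : ℂ) * latticeFourier u k

/-- The norm of `L^r_h`, for `1 ≤ r ≤ ∞`: `(h^d ∑_x |f(x)|^r)^{1/r}` if `r < ∞`, and
`sup_x |f(x)|` if `r = ∞`. -/
noncomputable def latticeNorm {M d : ℕ} [NeZero M] (r : ℝ≥0∞) (f : Lattice M d → ℂ) : ℝ :=
  if r = ∞ then ⨆ x : Lattice M d, ‖f x‖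
  else (mesh M ^ d * ∑ x : Lattice M d, ‖f x‖ ^ r.toReal) ^ (1 / r.toReal)

/-- Lattice-admissible pairs `(q, r)` in dimension `d`. -/
def LatticeAdmissible (d : ℕ) (q r : ℝ≥0∞) : Prop :=
  2 ≤ q ∧ 2 ≤ r ∧ 3 / q + (d : ℝ≥0∞) / r = (d : ℝ≥0∞) / 2 ∧ ¬ (q = 2 ∧ r = ∞ ∧ d = 3)

end PeriodicLattice

/-!
The estimate is proved first for data with frequencies in a cube `[-N, N)^d`, `1 ≤ N ≤ M`, and then
summed over dyadic shells, where `ε` pays for the logarithm lost on each of them and for the sum.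

* The kernel of the propagator restricted to such a cube is a product over the coordinates of
  exponential sums `∑ k ∈ [-N, N), e^{i (k x - t φ(k))}`, with `φ(k) = (2 / h ^ 2) (1 - cos (h k))`.
  The second derivative of `φ` degenerates at `h |k| = π / 2`, which is why only a decay of order
  `1 / 3` is available: `norm_kernel_le` bounds the sum by `180 (N / |t|) ^ (1 / 3)` for
  `|t| ≤ 1 / N`. On this time scale the increments of the phase, for `x` shifted into `[-π, π]`, are
  at most `π + 2 < 2 π` in absolute value, so the Kusmin–Landau inequality
  (`norm_sum_exp_le_of_monotone`) applies away from the few frequencies where they are small. No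
  Poisson summation and no smooth cutoff is needed.
* Riesz–Thorin interpolation of a bilinear form on a finite set (`norm_bilin_le_of_sum_le_one`, from
  the three lines theorem) turns this bound and Bessel's inequality into an `L^{r'} → L^r` bound.
* The `TT*` argument is run on `N` discrete times of spacing `1 / N ^ 2`
  (`sum_rpow_le_of_gram`, `sum_latticeNorm_rpow_le`). By the admissibility relation the interpolated
  kernel is a constant times `|i - j| ^ (-2 / q)`, and a Schur test replaces the
  Hardy–Littlewood–Sobolev inequality at the price of the factor `(log N) ^ (1 / q)`. This includes
  the endpoint `q = 2`.
* Averaging over the base point of such a set of times gives the estimate on `[0, 1 / N]`, and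
  adding `N` of these intervals the one on `[0, 1]`, with constant
  `N ^ (2 / q) (3 + 2 log N) ^ (1 / q)` up to a numerical factor (`eLpNorm_propagator_le_of_cube`).

For `q = ∞` admissibility forces `r = 2`, and Plancherel's theorem suffices.
-/

namespace PeriodicLattice

open Finset

/-! ### Summation by parts and the Kusmin–Landau inequality -/

/-- The inverse of `e^{2iy} - 1`, written in Cartesian form. -/
noncomputable def abelWeight (y : ℝ) : ℂ := -1 / 2 - Complex.I / 2 * (Real.cot y : ℂ)

lemma abelWeight_eq {y : ℝ} (hy : Real.sin y ≠ 0) :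
    abelWeight y = -(Complex.I / 2) * Complex.exp (-(y * Complex.I)) / (Real.sin y : ℂ) := by
  have h3 : (Complex.sin y : ℂ) ≠ 0 := by exact_mod_cast hy
  rw [abelWeight, Real.cot_eq_cos_div_sin, ← neg_mul, Complex.exp_mul_I, Complex.cos_neg,
    Complex.sin_neg]
  push_cast
  field_simp
  linear_combination (-Complex.sin y) * Complex.I_sq

lemma exp_sub_one_mul_abelWeight {y : ℝ} (hy : Real.sin y ≠ 0) :
    (Complex.exp (Complex.I * ((2 * y : ℝ) : ℂ)) - 1) * abelWeight y = 1 := by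
  have h3 : (Complex.sin y : ℂ) ≠ 0 := by exact_mod_cast hy
  have h1 : Complex.exp (Complex.I * ((2 * y : ℝ) : ℂ)) =
      Complex.exp (y * Complex.I) * Complex.exp (y * Complex.I) := by
    rw [← Complex.exp_add]; congr 1; push_cast; ring
  have h2 : Complex.exp (y * Complex.I) * Complex.exp (-(y * Complex.I)) = 1 := by
    rw [← Complex.exp_add]; simp
  have h4 : Complex.exp (y * Complex.I) - Complex.exp (-(y * Complex.I)) =
      2 * Complex.I * Complex.sin y := by
    rw [← neg_mul, Complex.exp_mul_I, Complex.exp_mul_I, Complex.cos_neg, Complex.sin_neg]; ring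
  rw [abelWeight_eq hy, h1]
  push_cast
  field_simp
  linear_combination (Complex.I * (-Complex.exp (y * Complex.I))) * h2 - Complex.I * h4 -
    2 * Complex.sin y * Complex.I_sq

lemma norm_abelWeight {y : ℝ} (hy : Real.sin y ≠ 0) : ‖abelWeight y‖ = 1 / (2 * |Real.sin y|) := by
  rw [abelWeight_eq hy, ← neg_mul, ← Complex.ofReal_neg]
  rw [norm_div, norm_mul, Complex.norm_exp_ofReal_mul_I, Complex.norm_real]
  simp [div_eq_mul_inv, mul_comm]

lemma abs_cot_le {y : ℝ} (hy : Real.sin y ≠ 0) : |Real.cot y| ≤ 1 / |Real.sin y| := by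
  rw [Real.cot_eq_cos_div_sin, abs_div]
  gcongr
  exact Real.abs_cos_le_one y

lemma cot_le_cot {a b : ℝ} (ha : 0 < a) (hab : a ≤ b) (hb : b < Real.pi) :
    Real.cot b ≤ Real.cot a := by
  have h1 : 0 < Real.sin a := Real.sin_pos_of_pos_of_lt_pi ha (by linarith)
  have h2 : 0 < Real.sin b := Real.sin_pos_of_pos_of_lt_pi (by linarith) hb
  have h3 : 0 ≤ Real.sin (b - a) := Real.sin_nonneg_of_nonneg_of_le_pi (by linarith) (by linarith)
  rw [Real.sin_sub] at h3
  rw [Real.cot_eq_cos_div_sin, Real.cot_eq_cos_div_sin, div_le_div_iff₀ h2 h1]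
  linarith

/-- Summation by parts behind the Kusmin–Landau inequality: each term `e^{iF(k)}` is the difference
`e^{iF(k+1)} - e^{iF(k)}` times a weight depending on the increment of `F`, and the variation of the
weights telescopes because the cotangents are monotone. -/
lemma norm_sum_sub_le_cot (F : ℕ → ℝ) (n : ℕ)
    (hs : ∀ k ≤ n, Real.sin ((F (k + 1) - F k) / 2) ≠ 0)
    (hc : ∀ k < n, Real.cot ((F (k + 2) - F (k + 1)) / 2) ≤ Real.cot ((F (k + 1) - F k) / 2)) :
    ‖∑ k ∈ range (n + 1), Complex.exp (Complex.I * (F k : ℂ)) -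
        Complex.exp (Complex.I * (F (n + 1) : ℂ)) * abelWeight ((F (n + 1) - F n) / 2)‖
      ≤ ‖abelWeight ((F 1 - F 0) / 2)‖ +
        (Real.cot ((F 1 - F 0) / 2) - Real.cot ((F (n + 1) - F n) / 2)) / 2 := by
  have key : ∀ k ≤ n, Complex.exp (Complex.I * (F k : ℂ)) =
      (Complex.exp (Complex.I * (F (k + 1) : ℂ)) - Complex.exp (Complex.I * (F k : ℂ))) *
        abelWeight ((F (k + 1) - F k) / 2) := by
    intro k hk
    have h1 := exp_sub_one_mul_abelWeight (hs k hk)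
    have h2 : Complex.exp (Complex.I * (F (k + 1) : ℂ)) = Complex.exp (Complex.I * (F k : ℂ)) *
        Complex.exp (Complex.I * ((2 * ((F (k + 1) - F k) / 2) : ℝ) : ℂ)) := by
      rw [← Complex.exp_add]; congr 1; push_cast; ring
    rw [h2]
    linear_combination (-Complex.exp (Complex.I * (F k : ℂ))) * h1
  have hexp : ∀ k, ‖Complex.exp (Complex.I * (F k : ℂ))‖ = 1 := fun k => by
    rw [mul_comm]; exact Complex.norm_exp_ofReal_mul_I _
  induction n with
  | zero =>
    have h0 := key 0 le_rfl
    have h1 : ∑ k ∈ range (0 + 1), Complex.exp (Complex.I * (F k : ℂ)) -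
        Complex.exp (Complex.I * (F (0 + 1) : ℂ)) * abelWeight ((F (0 + 1) - F 0) / 2) =
        - (Complex.exp (Complex.I * (F 0 : ℂ)) * abelWeight ((F (0 + 1) - F 0) / 2)) := by
      rw [zero_add, range_one, sum_singleton]
      linear_combination h0
    rw [h1, norm_neg, norm_mul, hexp]
    simp
  | succ n ih =>
    have ih' := ih (fun k hk => hs k (by omega)) (fun k hk => hc k (by omega))
      (fun k hk => key k (by omega))
    have hk := key (n + 1) le_rfl
    have hc' := hc n (by omega)
    rw [sum_range_succ]
    have h1 : ∑ k ∈ range (n + 1), Complex.exp (Complex.I * (F k : ℂ)) +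
        Complex.exp (Complex.I * (F (n + 1) : ℂ)) -
        Complex.exp (Complex.I * (F (n + 1 + 1) : ℂ)) *
          abelWeight ((F (n + 1 + 1) - F (n + 1)) / 2) =
        (∑ k ∈ range (n + 1), Complex.exp (Complex.I * (F k : ℂ)) -
          Complex.exp (Complex.I * (F (n + 1) : ℂ)) * abelWeight ((F (n + 1) - F n) / 2)) +
        Complex.exp (Complex.I * (F (n + 1) : ℂ)) * (abelWeight ((F (n + 1) - F n) / 2) -
          abelWeight ((F (n + 1 + 1) - F (n + 1)) / 2)) := by
      linear_combination hk
    have h2 : ‖abelWeight ((F (n + 1) - F n) / 2) - abelWeight ((F (n + 1 + 1) - F (n + 1)) / 2)‖ =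
        (Real.cot ((F (n + 1) - F n) / 2) - Real.cot ((F (n + 1 + 1) - F (n + 1)) / 2)) / 2 := by
      have : abelWeight ((F (n + 1) - F n) / 2) - abelWeight ((F (n + 1 + 1) - F (n + 1)) / 2) =
        -(Complex.I) * (((Real.cot ((F (n + 1) - F n) / 2) -
          Real.cot ((F (n + 1 + 1) - F (n + 1)) / 2)) / 2 : ℝ) : ℂ) := by
        simp only [abelWeight]; push_cast; ring
      rw [this, norm_mul, norm_neg, Complex.norm_I, one_mul, Complex.norm_real, Real.norm_eq_abs,
        abs_of_nonneg]
      linarith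
    rw [h1]
    refine (norm_add_le _ _).trans ?_
    rw [norm_mul, hexp, one_mul, h2]
    linarith

/-- **Kusmin–Landau inequality** for an exponential sum whose phase has nondecreasing increments
in `(0, 2π)`. -/
lemma norm_sum_exp_le_of_monotone (F : ℕ → ℝ) (n : ℕ) {σ : ℝ} (hσ : 0 < σ)
    (hpos : ∀ k < n, 0 < F (k + 1) - F k) (hlt : ∀ k < n, F (k + 1) - F k < 2 * Real.pi)
    (hmono : ∀ k, k + 1 < n → F (k + 1) - F k ≤ F (k + 2) - F (k + 1))
    (hsin : ∀ k < n, σ ≤ Real.sin ((F (k + 1) - F k) / 2)) :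
    ‖∑ k ∈ range n, Complex.exp (Complex.I * (F k : ℂ))‖ ≤ 2 / σ := by
  rcases n with _ | n
  · simpa using by positivity
  have hs : ∀ k ≤ n, Real.sin ((F (k + 1) - F k) / 2) ≠ 0 := fun k hk =>
    (hσ.trans_le (hsin k (by omega))).ne'
  have h := norm_sum_sub_le_cot F n hs (fun k hk => cot_le_cot
    (by linarith [hpos k (by omega)]) (by linarith [hmono k (by omega)])
    (by linarith [hlt (k + 1) (by omega)]))
  have hw : ∀ k ≤ n, ‖abelWeight ((F (k + 1) - F k) / 2)‖ ≤ 1 / (2 * σ) := fun k hk => by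
    rw [norm_abelWeight (hs k hk)]
    gcongr
    exact (hsin k (by omega)).trans (le_abs_self _)
  have hcot : ∀ k ≤ n, |Real.cot ((F (k + 1) - F k) / 2)| ≤ 1 / σ := fun k hk => by
    refine (abs_cot_le (hs k hk)).trans ?_
    gcongr
    exact (hsin k (by omega)).trans (le_abs_self _)
  have h1 := norm_sub_norm_le (∑ k ∈ range (n + 1), Complex.exp (Complex.I * (F k : ℂ)))
    (Complex.exp (Complex.I * (F (n + 1) : ℂ)) * abelWeight ((F (n + 1) - F n) / 2))
  rw [norm_mul, mul_comm Complex.I, Complex.norm_exp_ofReal_mul_I, one_mul] at h1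
  have h2 := hw 0 (by omega)
  have h3 := hw n le_rfl
  have h4 := abs_le.1 (hcot 0 (by omega))
  have h5 := abs_le.1 (hcot n le_rfl)
  have h6 : 1 / (2 * σ) = 1 / σ / 2 := by field_simp
  have h7 : 2 / σ = 2 * (1 / σ) := by ring
  simp only [zero_add] at h2 h4
  rw [mul_comm (Complex.ofReal _) Complex.I] at h1
  linarith [h4.1, h4.2, h5.1, h5.2]

/-- The points of a finite range satisfying a downward closed predicate form an initial segment. -/
lemma exists_initial_segment (p : ℕ → Prop) (n : ℕ) (hp : ∀ k l, k ≤ l → l < n → p l → p k) :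
    ∃ a ≤ n, ∀ k < n, (p k ↔ k < a) := by
  classical
  by_cases h : ∃ k, k < n ∧ ¬ p k
  · refine ⟨Nat.find h, (Nat.find_spec h).1.le, fun k hk => ⟨fun hpk => ?_, fun hlt => ?_⟩⟩
    · by_contra hge
      exact (Nat.find_spec h).2 (hp _ k (not_lt.1 hge) hk hpk)
    · have := Nat.find_min h hlt
      tauto
  · push Not at h
    exact ⟨n, le_rfl, fun k hk => ⟨fun _ => hk, fun _ => h k hk⟩⟩

/-- Increments `g ∈ [θ, π + 2]` stay away from `2πℤ`, with a bound linear in `θ`. -/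
lemma sin_half_ge {g θ : ℝ} (hθ0 : 0 < θ) (hθ1 : θ ≤ 1) (h1 : θ ≤ g) (h2 : g ≤ Real.pi + 2) :
    θ / Real.pi ≤ Real.sin (g / 2) := by
  have hpi := Real.pi_gt_three
  rcases le_total g Real.pi with h | h
  · calc θ / Real.pi ≤ 2 / Real.pi * (g / 2) := by
          rw [div_mul_div_comm, div_le_div_iff₀ (by positivity) (by positivity)]; nlinarith
      _ ≤ _ := Real.mul_le_sin (by linarith) (by linarith)
  · rw [← Real.sin_pi_sub]
    calc θ / Real.pi ≤ 2 / Real.pi * (Real.pi - g / 2) := by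
          rw [div_mul_eq_mul_div]; gcongr; linarith
      _ ≤ _ := Real.mul_le_sin (by linarith) (by linarith)

/-! ### Exponential sums with separated phase increments -/

/-- Van der Corput type bound for phases with increasing increments. If the increments `g` satisfy
`g l - g k ≥ θ ^ 3 (l - k) ^ 2`, at most `O(θ⁻¹)` of them are smaller than `θ` in absolute value,
and the Kusmin–Landau inequality controls the rest. -/
lemma norm_sum_exp_le_of_separated (F : ℕ → ℝ) (n : ℕ) {θ : ℝ} (hθ : 0 < θ) (hθ1 : θ ≤ 1)
    (hb : ∀ k < n, |F (k + 1) - F k| ≤ Real.pi + 2)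
    (hsep : ∀ k l, k ≤ l → l < n →
      θ ^ 3 * ((l : ℝ) - k) ^ 2 ≤ (F (l + 1) - F l) - (F (k + 1) - F k)) :
    ‖∑ k ∈ range n, Complex.exp (Complex.I * (F k : ℂ))‖ ≤ 20 / θ := by
  have hpi := Real.pi_gt_three
  have hpi' : Real.pi < 3.15 := Real.pi_lt_d2
  have hmono : ∀ k l, k ≤ l → l < n → F (k + 1) - F k ≤ F (l + 1) - F l := fun k l hkl hl => by
    have h1 := hsep k l hkl hl
    have h2 : 0 ≤ θ ^ 3 * ((l : ℝ) - k) ^ 2 := by positivity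
    linarith
  obtain ⟨a, han, ha⟩ := exists_initial_segment (fun k => F (k + 1) - F k ≤ -θ) n
    (fun k l hkl hl hp => (hmono k l hkl hl).trans hp)
  obtain ⟨b, hbn, hb'⟩ := exists_initial_segment (fun k => F (k + 1) - F k < θ) n
    (fun k l hkl hl hp => (hmono k l hkl hl).trans_lt hp)
  have hab : a ≤ b := by
    by_contra! h
    have h1 := (ha b (by omega)).2 h
    have h2 := (hb' b (by omega)).not.2 (lt_irrefl b)
    exact h2 (by linarith)
  -- On the initial segment the increments become positive after adding `2 π k` to the phase.
  have h1 : ‖∑ k ∈ range a, Complex.exp (Complex.I * (F k : ℂ))‖ ≤ 2 / (θ / Real.pi) := by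
    have hcongr : ∀ k, Complex.exp (Complex.I * (F k : ℂ)) =
        Complex.exp (Complex.I * ((F k + 2 * Real.pi * k : ℝ) : ℂ)) := fun k => by
      rw [show Complex.I * ((F k + 2 * Real.pi * k : ℝ) : ℂ) =
        Complex.I * (F k : ℂ) + k * (2 * Real.pi * Complex.I) by push_cast; ring,
        Complex.exp_add, Complex.exp_nat_mul_two_pi_mul_I, mul_one]
    simp_rw [hcongr]
    have hinc : ∀ k : ℕ, (F (k + 1) + 2 * Real.pi * ((k + 1 : ℕ) : ℝ)) - (F k + 2 * Real.pi * k) =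
        F (k + 1) - F k + 2 * Real.pi := fun k => by push_cast; ring
    refine norm_sum_exp_le_of_monotone (fun k => F k + 2 * Real.pi * k) a (by positivity)
      (fun k hk => ?_) (fun k hk => ?_) (fun k hk => ?_) (fun k hk => ?_)
    · simp only [hinc]
      have := (abs_le.1 (hb k (by omega))).1
      linarith
    · simp only [hinc]
      have := (ha k (by omega)).2 hk
      linarith
    · simp only [hinc]
      linarith [hmono k (k + 1) (by omega) (by omega)]
    · simp only [hinc]
      have h2 := (ha k (by omega)).2 hk
      have h3 := sin_half_ge (g := -(F (k + 1) - F k)) hθ hθ1 (by linarith)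
        (by linarith [(abs_le.1 (hb k (by omega))).1])
      rw [← Real.sin_pi_sub] at h3
      convert h3 using 2
      ring
  -- The middle segment is estimated by its length, which the separation hypothesis bounds.
  have h2 : ‖∑ k ∈ Ico a b, Complex.exp (Complex.I * (F k : ℂ))‖ ≤ 5 / 2 / θ := by
    refine (norm_sum_le _ _).trans ?_
    have : ∀ k ∈ Ico a b, ‖Complex.exp (Complex.I * (F k : ℂ))‖ = 1 := fun k _ => by
      rw [mul_comm]; exact Complex.norm_exp_ofReal_mul_I _
    rw [sum_congr rfl this, sum_const, Nat.card_Ico, nsmul_eq_mul, mul_one]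
    rcases hab.eq_or_lt with rfl | hlt
    · simp; positivity
    have h3 := hsep a (b - 1) (by omega) (by omega)
    have h4 := (hb' (b - 1) (by omega)).2 (by omega)
    have h5 := (ha a (by omega)).not.2 (lt_irrefl a)
    have h6 : ((b - 1 : ℕ) : ℝ) - a = ((b - a : ℕ) : ℝ) - 1 := by
      rw [Nat.cast_sub hab, Nat.cast_sub (by omega)]; push_cast; ring
    rw [h6] at h3
    set m : ℝ := ((b - a : ℕ) : ℝ) - 1 with hm
    have h7 : θ * (θ * m) ^ 2 ≤ θ * 2 := by nlinarith
    have h8 : (θ * m) ^ 2 ≤ 2 := le_of_mul_le_mul_left h7 hθ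
    have h9 : θ * m ≤ 3 / 2 := by nlinarith
    rw [le_div_iff₀ hθ]
    have : ((b - a : ℕ) : ℝ) = m + 1 := by rw [hm]; ring
    rw [this]; nlinarith
  have h3 : ‖∑ k ∈ Ico b n, Complex.exp (Complex.I * (F k : ℂ))‖ ≤ 2 / (θ / Real.pi) := by
    rw [sum_Ico_eq_sum_range]
    refine norm_sum_exp_le_of_monotone (fun k => F (b + k)) (n - b) (by positivity)
      (fun k hk => ?_) (fun k hk => ?_) (fun k hk => ?_) (fun k hk => ?_)
    · have := (hb' (b + k) (by omega)).not.2 (by omega)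
      simp only [← add_assoc]
      linarith
    · have := (abs_le.1 (hb (b + k) (by omega))).2
      simp only [← add_assoc]
      linarith
    · simpa only [← add_assoc] using hmono (b + k) (b + k + 1) (by omega) (by omega)
    · have := (hb' (b + k) (by omega)).not.2 (by omega)
      simp only [← add_assoc]
      exact sin_half_ge hθ hθ1 (by linarith) ((abs_le.1 (hb (b + k) (by omega))).2)
  rw [← sum_range_add_sum_Ico _ hbn, ← sum_range_add_sum_Ico _ hab]
  refine (norm_add₃_le).trans ?_
  have h4 : 2 / (θ / Real.pi) = 2 * Real.pi * (1 / θ) := by field_simp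
  have h5 : 0 < 1 / θ := by positivity
  have h6 : 20 / θ = 20 * (1 / θ) := by ring
  have h7 : 5 / 2 / θ = 5 / 2 * (1 / θ) := by ring
  rw [h4] at h1 h3
  rw [h6]; rw [h7] at h2
  nlinarith

/-- The case of decreasing increments, by complex conjugation. -/
lemma norm_sum_exp_le_of_separated_neg (F : ℕ → ℝ) (n : ℕ) {θ : ℝ} (hθ : 0 < θ) (hθ1 : θ ≤ 1)
    (hb : ∀ k < n, |F (k + 1) - F k| ≤ Real.pi + 2)
    (hsep : ∀ k l, k ≤ l → l < n →
      θ ^ 3 * ((l : ℝ) - k) ^ 2 ≤ (F (k + 1) - F k) - (F (l + 1) - F l)) :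
    ‖∑ k ∈ range n, Complex.exp (Complex.I * (F k : ℂ))‖ ≤ 20 / θ := by
  have h := norm_sum_exp_le_of_separated (fun k => -F k) n hθ hθ1
    (fun k hk => by simpa [neg_add_eq_sub, abs_sub_comm] using hb k hk)
    (fun k l hkl hl => by linarith [hsep k l hkl hl])
  rw [← Complex.norm_conj, map_sum]
  convert h using 4 with k
  rw [← Complex.exp_conj]
  simp

/-- A quantitative strict monotonicity of the sine on `[-π/2, π/2]`: it degenerates quadratically at
the end points, but is linear on intervals `[-ρ, ρ]` that stay away from them. -/
lemma sin_sub_sin_ge {a b ρ : ℝ} (hρ : 0 < ρ) (hba : b ≤ a) (ha : a ≤ Real.pi / 2)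
    (hb : -(Real.pi / 2) ≤ b) (haρ : |a| ≤ ρ) (hbρ : |b| ≤ ρ) :
    (a - b) ^ 2 / (20 * ρ) ≤ Real.sin a - Real.sin b := by
  have hpi := Real.pi_gt_three
  have hpi' : Real.pi < 3.15 := Real.pi_lt_d2
  rw [abs_le] at haρ hbρ
  rw [Real.sin_sub_sin]
  have h1 : 2 / Real.pi * ((a - b) / 2) ≤ Real.sin ((a - b) / 2) :=
    Real.mul_le_sin (by linarith) (by linarith)
  have h1' : (a - b) / 4 ≤ Real.sin ((a - b) / 2) := by
    refine le_trans ?_ h1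
    rw [div_mul_div_comm, div_le_div_iff₀ (by positivity) (by positivity)]; nlinarith
  have h2 : 1 - 2 / Real.pi * |(a + b) / 2| ≤ Real.cos ((a + b) / 2) := by
    rw [← Real.cos_abs]
    exact Real.one_sub_mul_le_cos (abs_nonneg _) (abs_le.2 ⟨by linarith, by linarith⟩)
  have h3 : (a - b) / (10 * ρ) ≤ 1 - 2 / Real.pi * |(a + b) / 2| := by
    rcases le_total ρ 1 with h | h
    · have h4 : |(a + b) / 2| ≤ 1 := abs_le.2 ⟨by linarith, by linarith⟩
      have h5 : 2 / Real.pi * |(a + b) / 2| ≤ 2 / 3 * 1 := by gcongr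
      have h6 : (a - b) / (10 * ρ) ≤ 1 / 5 := by
        rw [div_le_div_iff₀ (by positivity) (by positivity)]; linarith
      linarith
    · have h4 : |(a + b) / 2| ≤ Real.pi / 2 - (a - b) / 2 := abs_le.2 ⟨by linarith, by linarith⟩
      have h5 : 2 / Real.pi * |(a + b) / 2| ≤ 2 / Real.pi * (Real.pi / 2 - (a - b) / 2) := by
        gcongr
      have h6 : 2 / Real.pi * (Real.pi / 2 - (a - b) / 2) = 1 - (a - b) / Real.pi := by
        field_simp
      have h7 : (a - b) / (10 * ρ) ≤ (a - b) / Real.pi := by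
        apply div_le_div_of_nonneg_left (by linarith) (by positivity) (by linarith)
      linarith
  calc (a - b) ^ 2 / (20 * ρ) = 2 * ((a - b) / 4) * ((a - b) / (10 * ρ)) := by
        field_simp; ring
    _ ≤ 2 * Real.sin ((a - b) / 2) * Real.cos ((a + b) / 2) := by
        refine mul_le_mul (by linarith) (h3.trans h2) (div_nonneg (by linarith) (by positivity)) ?_
        linarith

/-! ### The dispersive estimate for the one-dimensional kernel -/

lemma mesh_pos (M : ℕ) [NeZero M] : 0 < mesh M :=
  div_pos Real.pi_pos (by exact_mod_cast Nat.pos_of_ne_zero (NeZero.ne M))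

lemma mesh_mul (M : ℕ) [NeZero M] : mesh M * M = Real.pi :=
  div_mul_cancel₀ _ (by exact_mod_cast NeZero.ne M)

/-- The one-dimensional dispersion relation `(4 / h ^ 2) sin ^ 2 (h k / 2)`: the symbol of `-Δ_h` on
`ℤ / 2 M ℤ`. -/
noncomputable def dispersion (M : ℕ) (k : ℤ) : ℝ :=
  2 / mesh M ^ 2 * (1 - Real.cos (mesh M * k))

lemma dispersion_add_one_sub (M : ℕ) (k : ℤ) :
    dispersion M (k + 1) - dispersion M k =
      4 / mesh M ^ 2 * Real.sin (mesh M / 2) * Real.sin (mesh M * (k + 1 / 2)) := by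
  have h1 := Real.cos_sub_cos (mesh M * k) (mesh M * (k + 1))
  have h2 : (mesh M * k + mesh M * (k + 1)) / 2 = mesh M * (k + 1 / 2) := by ring
  have h3 : (mesh M * k - mesh M * (k + 1)) / 2 = - (mesh M / 2) := by ring
  rw [h2, h3, Real.sin_neg] at h1
  simp only [dispersion]
  push_cast
  linear_combination (2 / mesh M ^ 2) * h1

/-- The phase `k x - t φ(k)` of the one-dimensional kernel. -/
noncomputable def kernelPhase (M : ℕ) (t x : ℝ) (k : ℤ) : ℝ := k * x - t * dispersion M k

lemma kernelPhase_add_one_sub (M : ℕ) (t x : ℝ) (k : ℤ) :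
    kernelPhase M t x (k + 1) - kernelPhase M t x k =
      x - t * (4 / mesh M ^ 2 * Real.sin (mesh M / 2)) * Real.sin (mesh M * (k + 1 / 2)) := by
  have := dispersion_add_one_sub M k
  simp only [kernelPhase]
  push_cast
  linear_combination (-t) * this

/-- The velocity coefficient `(4 / h ^ 2) sin (h / 2)` is comparable to `h⁻¹`. -/
lemma velocity_bounds (M : ℕ) [NeZero M] :
    4 / (Real.pi * mesh M) ≤ 4 / mesh M ^ 2 * Real.sin (mesh M / 2) ∧
      4 / mesh M ^ 2 * Real.sin (mesh M / 2) ≤ 2 / mesh M := by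
  have h := mesh_pos M
  have hM : (1 : ℝ) ≤ M := by exact_mod_cast Nat.pos_of_ne_zero (NeZero.ne M)
  have h1 : mesh M ≤ Real.pi := by nlinarith [mesh_mul M, Real.pi_pos]
  constructor
  · calc 4 / (Real.pi * mesh M) = 4 / mesh M ^ 2 * (2 / Real.pi * (mesh M / 2)) := by
          field_simp
      _ ≤ _ := by
          gcongr
          exact Real.mul_le_sin (by linarith) (by linarith)
  · calc 4 / mesh M ^ 2 * Real.sin (mesh M / 2) ≤ 4 / mesh M ^ 2 * (mesh M / 2) := by
          gcongr
          exact Real.sin_le (by linarith)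
      _ = 2 / mesh M := by field_simp; ring

section

variable {M N : ℕ} [NeZero M] {t x θ : ℝ}

lemma abs_mesh_mul_le {z : ℤ} (hz1 : -(N : ℤ) ≤ z) (hz2 : z < N) :
    |mesh M * (z + 1 / 2)| ≤ mesh M * N := by
  have h := mesh_pos M
  rw [abs_mul, abs_of_pos h]
  have h1 : -(N : ℝ) ≤ z := by exact_mod_cast hz1
  have h2 : (z : ℝ) + 1 ≤ N := by exact_mod_cast hz2
  gcongr
  rw [abs_le]; constructor <;> linarith

lemma abs_kernelPhase_sub_le (hN : 1 ≤ N) (ht : 0 < t) (htN : t ≤ 1 / N) (hx : |x| ≤ Real.pi)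
    {z : ℤ} (hz1 : -(N : ℤ) ≤ z) (hz2 : z < N) :
    |kernelPhase M t x (z + 1) - kernelPhase M t x z| ≤ Real.pi + 2 := by
  have h := mesh_pos M
  obtain ⟨hv1, hv2⟩ := velocity_bounds M
  have hN' : (0 : ℝ) < N := by exact_mod_cast hN
  rw [kernelPhase_add_one_sub]
  set v := 4 / mesh M ^ 2 * Real.sin (mesh M / 2)
  have hv0 : 0 ≤ v := le_trans (by positivity) hv1
  have h1 : |t * v * Real.sin (mesh M * (z + 1 / 2))| ≤ 2 := by
    rw [abs_mul, abs_of_nonneg (by positivity)]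
    calc t * v * |Real.sin (mesh M * (z + 1 / 2))|
        ≤ 1 / N * (2 / mesh M) * (mesh M * N) := by
          gcongr
          exact Real.abs_sin_le_abs.trans (abs_mesh_mul_le hz1 hz2)
      _ = 2 := by field_simp
  exact (abs_sub _ _).trans (add_le_add hx h1)

/-- A lower bound of the sine differences turns into a separation of the phase increments. -/
lemma separation_of_sin (hN : 1 ≤ N) (ht : 0 < t) (hθ : θ ^ 3 = t / (16 * N)) {k l s : ℝ}
    (hs : (mesh M * k - mesh M * l) ^ 2 / (20 * (mesh M * N)) ≤ s) :
    θ ^ 3 * (k - l) ^ 2 ≤ t * (4 / mesh M ^ 2 * Real.sin (mesh M / 2)) * s := by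
  have h := mesh_pos M
  have hN' : (0 : ℝ) < N := by exact_mod_cast hN
  have hpi' : Real.pi < 3.15 := Real.pi_lt_d2
  calc θ ^ 3 * (k - l) ^ 2
      ≤ t / (5 * Real.pi * N) * (k - l) ^ 2 := by
        rw [hθ]; gcongr; linarith
    _ = t * (4 / (Real.pi * mesh M)) *
        ((mesh M * k - mesh M * l) ^ 2 / (20 * (mesh M * N))) := by
        field_simp; ring
    _ ≤ _ := by
        refine mul_le_mul ?_ hs (by positivity) ?_
        · have := (velocity_bounds M).1
          gcongr
        · exact mul_nonneg ht.le (le_trans (by positivity) (velocity_bounds M).1)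

/-- The part of the kernel where `|h k| ≤ π / 2`. -/
lemma norm_sum_middle_le (hN : 1 ≤ N) (ht : 0 < t) (htN : t ≤ 1 / N)
    (hx : |x| ≤ Real.pi) (hθ0 : 0 < θ) (hθ1 : θ ≤ 1) (hθ : θ ^ 3 = t / (16 * N))
    (c : ℤ) (n : ℕ) (hc1 : -(N : ℤ) ≤ c) (hc2 : c + n ≤ N) (hl : -(M : ℤ) ≤ 2 * c + 1)
    (hr : 2 * (c + n) ≤ M + 1) :
    ‖∑ k ∈ range n, Complex.exp (Complex.I * (kernelPhase M t x (c + k) : ℂ))‖ ≤ 20 / θ := by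
  have h := mesh_pos M
  have hN' : (0 : ℝ) < N := by exact_mod_cast hN
  have hM := mesh_mul M
  refine norm_sum_exp_le_of_separated_neg (fun k : ℕ => kernelPhase M t x (c + k)) n hθ0 hθ1
    (fun k hk => ?_) (fun k l hkl hln => ?_)
  · have := abs_kernelPhase_sub_le (M := M) hN ht htN hx (z := c + k) (by omega) (by omega)
    simpa [add_assoc] using this
  · have e := kernelPhase_add_one_sub M t x
    have e1 := e (c + k)
    have e2 := e (c + l)
    have hkl' : (k : ℝ) ≤ l := by exact_mod_cast hkl
    have hb1 : -(M : ℝ) ≤ 2 * c + 1 := by exact_mod_cast hl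
    have hb2 : 2 * ((c : ℝ) + l) + 1 ≤ M := by
      have : 2 * (c + l) + 1 ≤ (M : ℤ) := by omega
      exact_mod_cast this
    have hk0 : (0 : ℝ) ≤ k := by positivity
    have hsin := sin_sub_sin_ge (a := mesh M * ((c + l : ℤ) + 1 / 2))
      (b := mesh M * ((c + k : ℤ) + 1 / 2)) (ρ := mesh M * N) (by positivity)
      (by push_cast; gcongr)
      (by push_cast; nlinarith) (by push_cast; nlinarith)
      (abs_mesh_mul_le (by omega) (by omega)) (abs_mesh_mul_le (by omega) (by omega))
    have hsep := separation_of_sin (M := M) hN ht hθ hsin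
    simp only [Nat.cast_add, Nat.cast_one, ← add_assoc]
    push_cast at hsep e1 e2 ⊢
    rw [e1, e2]
    ring_nf at hsep ⊢
    exact hsep

/-- The parts of the kernel where `h k` is beyond `π / 2` in absolute value. The two cases of `hout`
are the positive and the negative frequencies; the reflections `a ↦ π - a` and `a ↦ -π - a` bring
the angles back to `[-π / 2, π / 2]`. -/
lemma norm_sum_outer_le (hN : 1 ≤ N) (hNM : N ≤ M) (ht : 0 < t) (htN : t ≤ 1 / N)
    (hx : |x| ≤ Real.pi) (hθ0 : 0 < θ) (hθ1 : θ ≤ 1) (hθ : θ ^ 3 = t / (16 * N))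
    (c : ℤ) (n : ℕ) (hc1 : -(N : ℤ) ≤ c) (hc2 : c + n ≤ N)
    (hout : (M : ℤ) ≤ 2 * c + 1 ∨ 2 * (c + n) - 1 ≤ -(M : ℤ)) :
    ‖∑ k ∈ range n, Complex.exp (Complex.I * (kernelPhase M t x (c + k) : ℂ))‖ ≤ 20 / θ := by
  have h := mesh_pos M
  have hN' : (0 : ℝ) < N := by exact_mod_cast hN
  have hNM' : (N : ℝ) ≤ M := by exact_mod_cast hNM
  have hM := mesh_mul M
  refine norm_sum_exp_le_of_separated (fun k : ℕ => kernelPhase M t x (c + k)) n hθ0 hθ1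
    (fun k hk => ?_) (fun k l hkl hln => ?_)
  · have := abs_kernelPhase_sub_le (M := M) hN ht htN hx (z := c + k) (by omega) (by omega)
    simpa [add_assoc] using this
  · have e := kernelPhase_add_one_sub M t x
    have e1 := e (c + k)
    have e2 := e (c + l)
    have hkl' : (k : ℝ) ≤ l := by exact_mod_cast hkl
    have hk0 : (0 : ℝ) ≤ k := by positivity
    have hcN : -(N : ℝ) ≤ c := by exact_mod_cast hc1
    have hlN : (c : ℝ) + l + 1 ≤ N := by
      have : c + l + 1 ≤ (N : ℤ) := by omega
      exact_mod_cast this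
    have hmul : ∀ {y z : ℝ}, y ≤ z → mesh M * y ≤ mesh M * z := fun hyz =>
      mul_le_mul_of_nonneg_left hyz h.le
    have hNpi := hmul hNM'
    have hkl2 := hmul (show (c : ℝ) + k + 1 / 2 ≤ c + l + 1 / 2 by linarith)
    have hup := hmul (show (c : ℝ) + l + 1 / 2 ≤ N by linarith)
    have hlo := hmul (show -(N : ℝ) ≤ c + k + 1 / 2 by linarith)
    have hsin : (mesh M * l - mesh M * k) ^ 2 / (20 * (mesh M * N)) ≤
        Real.sin (mesh M * (c + k + 1 / 2)) - Real.sin (mesh M * (c + l + 1 / 2)) := by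
      rcases hout with ho | ho
      · have hb : (M : ℝ) ≤ 2 * c + 1 := by exact_mod_cast ho
        have hb' := hmul (show (M : ℝ) / 2 ≤ c + k + 1 / 2 by linarith)
        rw [← mul_div_assoc] at hb'
        have := sin_sub_sin_ge (a := Real.pi - mesh M * (c + k + 1 / 2))
          (b := Real.pi - mesh M * (c + l + 1 / 2)) (ρ := mesh M * N) (by positivity)
          (by linarith) (by linarith) (by linarith)
          (abs_le.2 ⟨by linarith, by linarith⟩) (abs_le.2 ⟨by linarith, by linarith⟩)
        rw [Real.sin_pi_sub, Real.sin_pi_sub] at this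
        convert this using 2
        ring
      · have hb : 2 * ((c : ℝ) + l) + 1 ≤ -M := by
          have : 2 * (c + l) + 1 ≤ -(M : ℤ) := by omega
          exact_mod_cast this
        have hb' := hmul (show (c : ℝ) + l + 1 / 2 ≤ -(M / 2) by linarith)
        rw [mul_neg, ← mul_div_assoc] at hb'
        have := sin_sub_sin_ge (a := -(mesh M * (c + k + 1 / 2) + Real.pi))
          (b := -(mesh M * (c + l + 1 / 2) + Real.pi)) (ρ := mesh M * N) (by positivity)
          (by linarith) (by linarith) (by linarith)
          (abs_le.2 ⟨by linarith, by linarith⟩) (abs_le.2 ⟨by linarith, by linarith⟩)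
        rw [Real.sin_neg, Real.sin_neg, Real.sin_add_pi, Real.sin_add_pi, neg_neg,
          neg_neg] at this
        convert this using 2
        ring
    have hsep := separation_of_sin (M := M) hN ht hθ hsin
    simp only [Nat.cast_add, Nat.cast_one, ← add_assoc]
    push_cast at hsep e1 e2 ⊢
    rw [e1, e2]
    linarith

end

/-- The one-dimensional kernel of the propagator restricted to frequencies in `[-N, N)`. -/
noncomputable def kernel (M N : ℕ) (t x : ℝ) : ℂ :=
  ∑ k ∈ Ico (-(N : ℤ)) N, Complex.exp (Complex.I * (kernelPhase M t x k : ℂ))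

lemma sum_Ico_int_eq_sum_range (N : ℕ) (f : ℤ → ℂ) :
    ∑ k ∈ Ico (-(N : ℤ)) N, f k = ∑ k ∈ range (2 * N), f (-(N : ℤ) + k) := by
  refine (sum_bij (fun (k : ℕ) _ => -(N : ℤ) + k) (fun k hk => ?_) (fun a _ b _ hab => ?_)
    (fun b hb => ?_) (fun _ _ => rfl)).symm
  · simp only [mem_range, mem_Ico] at hk ⊢; omega
  · omega
  · simp only [mem_Ico] at hb
    exact ⟨(b + N).toNat, by simp only [mem_range]; omega, by omega⟩

lemma norm_kernel_le_of_abs_le_pi {M N : ℕ} [NeZero M] (hN : 1 ≤ N) (hNM : N ≤ M) {t x θ : ℝ}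
    (ht : 0 < t) (htN : t ≤ 1 / N) (hx : |x| ≤ Real.pi) (hθ0 : 0 < θ) (hθ1 : θ ≤ 1)
    (hθ : θ ^ 3 = t / (16 * N)) : ‖kernel M N t x‖ ≤ 60 / θ := by
  rw [kernel, sum_Ico_int_eq_sum_range]
  -- The number of `k` with `0 ≤ k < N` and `h (k + 1 / 2) ≤ π / 2`.
  set P := min N ((M + 1) / 2) with hP
  have h1 := norm_sum_outer_le (M := M) hN hNM ht htN hx hθ0 hθ1 hθ (-(N : ℤ)) (N - P) le_rfl
    (by omega)
  have h2 := norm_sum_middle_le (M := M) hN ht htN hx hθ0 hθ1 hθ (-(N : ℤ) + (N - P : ℕ)) (2 * P)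
    (by omega) (by omega) (by omega) (by omega)
  have h3 := norm_sum_outer_le (M := M) hN hNM ht htN hx hθ0 hθ1 hθ (-(N : ℤ) + (N + P : ℕ)) (N - P)
    (by omega) (by omega)
  have h1' : ‖∑ k ∈ range (N - P),
      Complex.exp (Complex.I * (kernelPhase M t x (-(N : ℤ) + k) : ℂ))‖ ≤ 20 / θ := by
    rcases le_total N ((M + 1) / 2) with h | h
    · rw [show N - P = 0 by omega]; simp; positivity
    · exact h1 (by omega)
  have h3' : ‖∑ k ∈ range (N - P),
      Complex.exp (Complex.I * (kernelPhase M t x (-(N : ℤ) + (N + P : ℕ) + k) : ℂ))‖ ≤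
        20 / θ := by
    rcases le_total N ((M + 1) / 2) with h | h
    · rw [show N - P = 0 by omega]; simp; positivity
    · exact h3 (by omega)
  rw [← sum_range_add_sum_Ico _ (show N - P ≤ 2 * N by omega),
    ← sum_Ico_consecutive _ (show N - P ≤ N + P by omega) (show N + P ≤ 2 * N by omega),
    sum_Ico_eq_sum_range _ (N - P), sum_Ico_eq_sum_range _ (N + P), ← add_assoc,
    show N + P - (N - P) = 2 * P by omega, show 2 * N - (N + P) = N - P by omega]
  refine norm_add₃_le.trans ?_
  have : 60 / θ = 20 / θ + 20 / θ + 20 / θ := by ring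
  rw [this]
  refine add_le_add (add_le_add h1' ?_) ?_
  · simpa only [Nat.cast_add, add_assoc] using h2
  · simpa only [Nat.cast_add, add_assoc] using h3'

/-- **Dispersive estimate** for the frequency-localized kernel, on the time scale `1 / N`. -/
lemma norm_kernel_le {M N : ℕ} [NeZero M] (hN : 1 ≤ N) (hNM : N ≤ M) {t : ℝ} (x : ℝ)
    (ht : t ≠ 0) (htN : |t| ≤ 1 / N) :
    ‖kernel M N t x‖ ≤ 180 * (N / |t|) ^ (1 / 3 : ℝ) := by
  have hN' : (1 : ℝ) ≤ N := by exact_mod_cast hN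
  have key : ∀ t x : ℝ, 0 < t → t ≤ 1 / N → ‖kernel M N t x‖ ≤ 180 * (N / t) ^ (1 / 3 : ℝ) := by
    intro t x ht htN
    -- Shift `x` by a multiple of `2 π` into `[-π, π]`.
    have hshift : ∀ m : ℤ, kernel M N t (x - m * (2 * Real.pi)) = kernel M N t x := fun m => by
      refine sum_congr rfl fun k _ => ?_
      rw [show Complex.I * (kernelPhase M t (x - m * (2 * Real.pi)) k : ℂ) =
        Complex.I * (kernelPhase M t x k : ℂ) + ((-(k * m) : ℤ) : ℂ) * (2 * Real.pi * Complex.I) by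
          simp only [kernelPhase]; push_cast; ring,
        Complex.exp_add, Complex.exp_int_mul_two_pi_mul_I, mul_one]
    rw [← hshift (round (x / (2 * Real.pi)))]
    have hx : |x - round (x / (2 * Real.pi)) * (2 * Real.pi)| ≤ Real.pi := by
      have h1 := abs_sub_round (x / (2 * Real.pi))
      have h2 : x - round (x / (2 * Real.pi)) * (2 * Real.pi) =
          (x / (2 * Real.pi) - round (x / (2 * Real.pi))) * (2 * Real.pi) := by
        field_simp
      rw [h2, abs_mul, abs_of_pos Real.two_pi_pos]
      nlinarith [Real.pi_pos]
    have ht1 : t ≤ 1 := htN.trans (by rw [div_le_one (by positivity)]; exact hN')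
    -- With this `θ` the number of frequencies at which the phase increment is below `θ` and the
    -- Kusmin–Landau bound for the others are both of order `1 / θ`.
    set θ : ℝ := (t / (16 * N)) ^ (1 / 3 : ℝ) with hθ
    have hle : t / (16 * N) ≤ 1 := by rw [div_le_one (by positivity)]; nlinarith
    have hθ3 : θ ^ 3 = t / (16 * N) := by
      rw [hθ, ← Real.rpow_natCast, ← Real.rpow_mul (by positivity)]; norm_num
    refine (norm_kernel_le_of_abs_le_pi hN hNM ht htN hx (θ := θ) (by positivity)
      (Real.rpow_le_one (by positivity) hle (by norm_num)) hθ3).trans ?_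
    have h1 : (1 / θ) = 16 ^ (1 / 3 : ℝ) * (N / t) ^ (1 / 3 : ℝ) := by
      rw [hθ, ← Real.mul_rpow (by norm_num) (by positivity), one_div,
        ← Real.inv_rpow (by positivity)]
      congr 1
      field_simp
    have h2 : (16 : ℝ) ^ (1 / 3 : ℝ) ≤ 3 := by
      calc (16 : ℝ) ^ (1 / 3 : ℝ) ≤ 27 ^ (1 / 3 : ℝ) := by gcongr; norm_num
        _ = 3 := by
          rw [show (27 : ℝ) = 3 ^ (3 : ℝ) by norm_num, ← Real.rpow_mul (by norm_num)]; norm_num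
    rw [div_eq_mul_one_div, h1]
    have h3 : (0 : ℝ) ≤ (N / t) ^ (1 / 3 : ℝ) := by positivity
    nlinarith
  rcases lt_or_gt_of_ne ht with h | h
  · have h1 := key (-t) (-x) (by linarith) (by rwa [abs_of_neg h] at htN)
    rw [abs_of_neg h]
    convert h1 using 1
    rw [← Complex.norm_conj, kernel, map_sum]
    congr 1
    refine sum_congr rfl fun k _ => ?_
    rw [← Complex.exp_conj]
    congr 1
    simp [kernelPhase]
    ring
  · rw [abs_of_pos h] at htN ⊢
    exact key t x h htN

lemma norm_kernel_le_trivial (M N : ℕ) (t x : ℝ) : ‖kernel M N t x‖ ≤ 2 * N := by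
  refine (norm_sum_le _ _).trans ?_
  have : ∀ k ∈ Ico (-(N : ℤ)) N, ‖Complex.exp (Complex.I * (kernelPhase M t x k : ℂ))‖ = 1 :=
    fun k _ => by rw [mul_comm]; exact Complex.norm_exp_ofReal_mul_I _
  rw [sum_congr rfl this]
  simp
  rw [← Int.cast_natCast, Int.toNat_of_nonneg (by positivity)]
  push_cast
  linarith

/-! ### Riesz–Thorin interpolation and duality on a finite set -/

section Interpolation

variable {X : Type*}

/-- The analytic family through `f` in the Riesz–Thorin argument: it has modulus `|f| ^ p` on
`Re z = 0`, modulus `|f| ^ (p / 2)` on `Re z = 1`, and equals `f` at `z = θ` when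
`p (1 - θ / 2) = 1`. -/
noncomputable def interpFamily (p : ℝ) (f : X → ℂ) (z : ℂ) (x : X) : ℂ :=
  if f x = 0 then 0 else ((‖f x‖ : ℝ) : ℂ) ^ ((p : ℂ) * (1 - z / 2)) * (f x / (‖f x‖ : ℝ))

lemma norm_interpFamily {p : ℝ} (f : X → ℂ) (z : ℂ) {x : X} (hx : f x ≠ 0) :
    ‖interpFamily p f z x‖ = ‖f x‖ ^ (p * (1 - z.re / 2)) := by
  have h0 : 0 < ‖f x‖ := norm_pos_iff.2 hx
  rw [interpFamily, if_neg hx, norm_mul, Complex.norm_cpow_eq_rpow_re_of_pos h0, norm_div,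
    Complex.norm_real, norm_norm, div_self h0.ne', mul_one]
  congr 1
  simp

lemma interpFamily_apply {p : ℝ} (f : X → ℂ) {θ : ℝ} (hθ : p * (1 - θ / 2) = 1) :
    interpFamily p f (θ : ℂ) = f := by
  funext x
  by_cases hx : f x = 0
  · simp [interpFamily, hx]
  have h0 : ((‖f x‖ : ℝ) : ℂ) ≠ 0 := by exact_mod_cast norm_ne_zero_iff.2 hx
  have h1 : (p : ℂ) * (1 - (θ : ℂ) / 2) = 1 := by exact_mod_cast hθ
  rw [interpFamily, if_neg hx, h1, Complex.cpow_one]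
  field_simp

lemma differentiable_interpFamily (p : ℝ) (f : X → ℂ) (x : X) :
    Differentiable ℂ fun z => interpFamily p f z x := by
  by_cases hx : f x = 0
  · simp [interpFamily, hx]
  have h0 : ((‖f x‖ : ℝ) : ℂ) ≠ 0 := by exact_mod_cast norm_ne_zero_iff.2 hx
  simp only [interpFamily, if_neg hx]
  intro z
  refine DifferentiableAt.mul_const ?_ _
  exact DifferentiableAt.const_cpow (by fun_prop) (Or.inl h0)

lemma norm_interpFamily_le {p : ℝ} (hp : 0 ≤ p) (f : X → ℂ) {z : ℂ}
    (hz : z.re ∈ Set.Icc (0 : ℝ) 1) (x : X) : ‖interpFamily p f z x‖ ≤ max 1 ‖f x‖ ^ p := by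
  by_cases hx : f x = 0
  · simp only [interpFamily, hx, if_true, norm_zero]; positivity
  rw [norm_interpFamily f z hx]
  calc ‖f x‖ ^ (p * (1 - z.re / 2)) ≤ max 1 ‖f x‖ ^ (p * (1 - z.re / 2)) := by
        have : 0 ≤ 1 - z.re / 2 := by linarith [hz.2]
        gcongr
        exact le_max_right _ _
    _ ≤ _ := Real.rpow_le_rpow_of_exponent_le (le_max_left _ _)
        (mul_le_of_le_one_right hp (by linarith [hz.1]))

variable [Fintype X]

lemma sum_norm_interpFamily {p : ℝ} (hp : 0 < p) (f : X → ℂ) {z : ℂ} (hz : z.re = 0) :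
    ∑ x, ‖interpFamily p f z x‖ = ∑ x, ‖f x‖ ^ p := by
  refine sum_congr rfl fun x _ => ?_
  by_cases hx : f x = 0
  · simp [interpFamily, hx, hp.ne']
  · rw [norm_interpFamily f z hx, hz]; simp

lemma sum_norm_sq_interpFamily {p : ℝ} (hp : 0 < p) (f : X → ℂ) {z : ℂ} (hz : z.re = 1) :
    ∑ x, ‖interpFamily p f z x‖ ^ 2 = ∑ x, ‖f x‖ ^ p := by
  refine sum_congr rfl fun x _ => ?_
  by_cases hx : f x = 0
  · simp [interpFamily, hx, hp.ne']
  · rw [norm_interpFamily f z hx, hz, ← Real.rpow_natCast, ← Real.rpow_mul (norm_nonneg _)]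
    congr 1
    push_cast
    ring

/-- **Riesz–Thorin interpolation** for a bilinear form on a finite set, between the exponents
`(1, 1)` and `(2, 2)`, for normalized arguments. -/
lemma norm_bilin_le_of_sum_le_one (K : X → X → ℂ) {A B θ p : ℝ} (hθ0 : 0 ≤ θ) (hθ1 : θ ≤ 1)
    (hp : p * (1 - θ / 2) = 1) (hA : 0 ≤ A) (hB : 0 ≤ B)
    (h1 : ∀ x y, ‖K x y‖ ≤ A)
    (h2 : ∀ f g : X → ℂ, ‖∑ x, ∑ y, K x y * f x * g y‖ ≤
      B * √(∑ x, ‖f x‖ ^ 2) * √(∑ x, ‖g x‖ ^ 2))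
    (f g : X → ℂ) (hf : ∑ x, ‖f x‖ ^ p ≤ 1) (hg : ∑ x, ‖g x‖ ^ p ≤ 1) :
    ‖∑ x, ∑ y, K x y * f x * g y‖ ≤ A ^ (1 - θ) * B ^ θ := by
  have hp0 : 0 < p := by
    by_contra! h
    nlinarith
  set Φ : ℂ → ℂ := fun z => ∑ x, ∑ y, K x y * interpFamily p f z x * interpFamily p g z y with hΦ
  have hd : Differentiable ℂ Φ := by
    have := differentiable_interpFamily p f
    have := differentiable_interpFamily p g
    fun_prop
  have hb : BddAbove ((norm ∘ Φ) '' Complex.HadamardThreeLines.verticalClosedStrip 0 1) := by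
    refine ⟨∑ x, ∑ y, ‖K x y‖ * max 1 ‖f x‖ ^ p * max 1 ‖g y‖ ^ p, ?_⟩
    rintro _ ⟨z, hz, rfl⟩
    refine (norm_sum_le _ _).trans (sum_le_sum fun x _ => (norm_sum_le _ _).trans
      (sum_le_sum fun y _ => ?_))
    rw [norm_mul, norm_mul]
    have e1 := norm_interpFamily_le hp0.le f hz x
    have e2 := norm_interpFamily_le hp0.le g hz y
    gcongr
  have hl : ∀ z ∈ Complex.re ⁻¹' {(0 : ℝ)}, ‖Φ z‖ ≤ A := by
    intro z hz
    have hz' : z.re = 0 := hz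
    have e1 := sum_norm_interpFamily hp0 f hz'
    have e2 := sum_norm_interpFamily hp0 g hz'
    calc ‖Φ z‖ ≤ ∑ x, ∑ y, A * ‖interpFamily p f z x‖ * ‖interpFamily p g z y‖ := by
          refine (norm_sum_le _ _).trans (sum_le_sum fun x _ => (norm_sum_le _ _).trans
            (sum_le_sum fun y _ => ?_))
          rw [norm_mul, norm_mul]
          have := h1 x y
          gcongr
      _ = A * (∑ x, ‖f x‖ ^ p) * (∑ x, ‖g x‖ ^ p) := by
          rw [← e1, ← e2, mul_assoc, sum_mul_sum, mul_sum]
          simp_rw [mul_sum, mul_assoc]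
      _ ≤ A * 1 * 1 := by gcongr
      _ = A := by ring
  have hr : ∀ z ∈ Complex.re ⁻¹' {(1 : ℝ)}, ‖Φ z‖ ≤ B := by
    intro z hz
    have hz' : z.re = 1 := hz
    have e1 := sum_norm_sq_interpFamily hp0 f hz'
    have e2 := sum_norm_sq_interpFamily hp0 g hz'
    refine (h2 _ _).trans ?_
    rw [e1, e2]
    calc B * √(∑ x, ‖f x‖ ^ p) * √(∑ x, ‖g x‖ ^ p) ≤ B * 1 * 1 := by
          gcongr <;> rwa [Real.sqrt_le_one]
      _ = B := by ring
  have := Complex.HadamardThreeLines.norm_le_interp_of_mem_verticalClosedStrip' (z := (θ : ℂ))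
    zero_lt_one (by simp [Complex.HadamardThreeLines.verticalClosedStrip, hθ0, hθ1])
    hd.diffContOnCl hb hl hr
  rw [hΦ] at this
  simpa [interpFamily_apply f hp, interpFamily_apply g hp] using this

/-- The exponents used by duality: for every `F` there is `g` which is normalized in the dual of
`L^r` and at which the pairing with `F` attains the norm of `F`. -/
lemma exists_dual_finite {r p : ℝ} (hr : 1 < r) (hpr : 1 / r + 1 / p = 1) (F : X → ℂ) :
    ∃ g : X → ℂ, ∑ x, ‖g x‖ ^ p ≤ 1 ∧
      ∑ x, F x * g x = (((∑ x, ‖F x‖ ^ r) ^ (1 / r) : ℝ) : ℂ) := by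
  have hr0 : 0 < r := by linarith
  have hp0 : 0 < p := by
    have : 1 / r < 1 := by rw [div_lt_one hr0]; exact hr
    exact one_div_pos.1 (by linarith)
  set S := ∑ x, ‖F x‖ ^ r with hS
  have hS0 : 0 ≤ S := sum_nonneg fun x _ => by positivity
  rcases hS0.eq_or_lt with h0 | h0
  · refine ⟨0, by simp [hp0.ne'], ?_⟩
    rw [← h0, Real.zero_rpow (by positivity)]
    simp
  have hexp : (r - 1) * p = r := by
    field_simp at hpr
    linarith
  -- The equality case of Hölder's inequality.
  refine ⟨fun x => ((S ^ (-(1 / p)) * ‖F x‖ ^ (r - 2) : ℝ) : ℂ) * (starRingEnd ℂ) (F x), ?_, ?_⟩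
  · have h1 : ∀ x, ‖((S ^ (-(1 / p)) * ‖F x‖ ^ (r - 2) : ℝ) : ℂ) * (starRingEnd ℂ) (F x)‖ ^ p =
        S⁻¹ * ‖F x‖ ^ r := by
      intro x
      rw [norm_mul, Complex.norm_real, Complex.norm_conj, Real.norm_of_nonneg (by positivity)]
      rcases (norm_nonneg (F x)).eq_or_lt with hx | hx
      · simp [← hx, Real.zero_rpow hp0.ne', Real.zero_rpow hr0.ne']
      rw [mul_assoc, ← Real.rpow_add_one hx.ne', Real.mul_rpow (by positivity) (by positivity),
        ← Real.rpow_mul h0.le, ← Real.rpow_mul hx.le, show r - 2 + 1 = r - 1 by ring, hexp,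
        show -(1 / p) * p = -1 by field_simp, Real.rpow_neg_one]
    rw [sum_congr rfl fun x _ => h1 x, ← mul_sum, inv_mul_cancel₀ h0.ne']
  · have h1 : ∀ x, F x * (((S ^ (-(1 / p)) * ‖F x‖ ^ (r - 2) : ℝ) : ℂ) * (starRingEnd ℂ) (F x)) =
        ((S ^ (-(1 / p)) * ‖F x‖ ^ r : ℝ) : ℂ) := by
      intro x
      rw [mul_left_comm, Complex.mul_conj, Complex.normSq_eq_norm_sq, ← Complex.ofReal_mul]
      congr 1
      rcases (norm_nonneg (F x)).eq_or_lt with hx | hx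
      · simp [← hx, Real.zero_rpow hr0.ne']
      rw [mul_assoc, ← Real.rpow_natCast, ← Real.rpow_add hx]
      congr 2
      push_cast; ring
    rw [sum_congr rfl fun x _ => h1 x, ← Complex.ofReal_sum, ← mul_sum, ← hS]
    congr 1
    rw [← Real.rpow_add_one h0.ne']
    congr 1
    linarith

lemma exists_dual_top [Nonempty X] (F : X → ℂ) :
    ∃ g : X → ℂ, ∑ x, ‖g x‖ ^ (1 : ℝ) ≤ 1 ∧ ∑ x, F x * g x = ((⨆ x, ‖F x‖ : ℝ) : ℂ) := by
  classical
  obtain ⟨x₀, hx₀⟩ := Finite.exists_max fun x => ‖F x‖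
  have hsup : (⨆ x, ‖F x‖) = ‖F x₀‖ :=
    le_antisymm (ciSup_le hx₀) (le_ciSup (Set.finite_range fun x => ‖F x‖).bddAbove x₀)
  refine ⟨Pi.single x₀ ((starRingEnd ℂ) (F x₀) / ‖F x₀‖), ?_, ?_⟩
  · rw [sum_eq_single x₀ (fun x _ hx => by simp [hx]) (by simp)]
    simp [div_self_le_one]
  · rw [sum_eq_single x₀ (fun x _ hx => by simp [hx]) (by simp), hsup, Pi.single_eq_same,
      ← mul_div_assoc, Complex.mul_conj, Complex.normSq_eq_norm_sq]
    rcases eq_or_ne (F x₀) 0 with h | h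
    · simp [h]
    · have : (‖F x₀‖ : ℂ) ≠ 0 := by exact_mod_cast norm_ne_zero_iff.2 h
      push_cast
      field_simp

end Interpolation

/-! ### The Schur test and the `TT*` argument -/

/-- A Schur test with exponents `(q', q')`: it replaces Young's convolution inequality. -/
lemma schur_test {I : Type*} [Fintype I] {q L : ℝ} (hq : 2 ≤ q) (hL : 0 < L) (b : I → ℝ)
    (hb : ∀ i, 0 ≤ b i) (w : I → I → ℝ) (hw : ∀ i j, 0 ≤ w i j) (hw1 : ∀ i, ∑ j, w i j ≤ L)
    (hw2 : ∀ j, ∑ i, w i j ≤ L) :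
    ∑ i, ∑ j, b i ^ (1 - 1 / q) * b j ^ (1 - 1 / q) * w i j ^ (2 / q) ≤
      L ^ (2 / q) * (∑ i, b i) ^ (2 - 2 / q) := by
  have hq0 : 0 < q := by linarith
  have hq1 : 1 / q ≤ 1 / 2 := by gcongr
  have hq2 : 0 < 1 / q := by positivity
  have h2q : 2 / q = 2 * (1 / q) := by ring
  set S := ∑ i, b i with hS
  have hS0 : 0 ≤ S := sum_nonneg fun i _ => hb i
  rcases hS0.eq_or_lt with h0 | h0
  · have hbi : ∀ i, b i = 0 := fun i =>
      (sum_eq_zero_iff_of_nonneg fun i _ => hb i).1 h0.symm i (mem_univ i)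
    simp only [hbi, Real.zero_rpow (show 1 - 1 / q ≠ 0 by linarith), zero_mul, sum_const_zero]
    positivity
  -- Pointwise AM–GM with weights `1 / q, 1 / q, 1 - 2 / q`, for three quantities normalized so that
  -- each of them has double sum at most `S`.
  have hterm : ∀ i j, b i ^ (1 - 1 / q) * b j ^ (1 - 1 / q) * w i j ^ (2 / q) ≤
      L ^ (2 / q) * S ^ (1 - 2 / q) *
        (1 / q * (w i j * b i / L) + 1 / q * (w i j * b j / L) +
          (1 - 2 / q) * (b i * b j / S)) := by
    intro i j
    have hbi := hb i
    have hbj := hb j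
    have hwij := hw i j
    have h := Real.geom_mean_le_arith_mean3_weighted (w₁ := 1 / q) (w₂ := 1 / q) (w₃ := 1 - 2 / q)
      (p₁ := w i j * b i / L) (p₂ := w i j * b j / L) (p₃ := b i * b j / S)
      hq2.le hq2.le (by linarith) (by positivity) (by positivity) (by positivity) (by ring)
    refine le_trans (le_of_eq ?_) (mul_le_mul_of_nonneg_left h (by positivity))
    have hw' : w i j ^ (2 / q) = w i j ^ (1 / q) * w i j ^ (1 / q) := by
      rw [← Real.rpow_add_of_nonneg hwij hq2.le hq2.le]; congr 1; ring
    have hL' : L ^ (2 / q) = L ^ (1 / q) * L ^ (1 / q) := by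
      rw [← Real.rpow_add hL]; congr 1; ring
    have hsplit : ∀ y : ℝ, 0 ≤ y → y ^ (1 - 1 / q) = y ^ (1 / q) * y ^ (1 - 2 / q) := fun y hy => by
      rw [← Real.rpow_add_of_nonneg hy hq2.le (by linarith)]; congr 1; ring
    rw [Real.div_rpow (by positivity) hL.le, Real.div_rpow (by positivity) hL.le,
      Real.div_rpow (by positivity) h0.le, Real.mul_rpow hwij hbi, Real.mul_rpow hwij hbj,
      Real.mul_rpow hbi hbj, hw', hL', hsplit _ hbi, hsplit _ hbj]
    have hLp : 0 < L ^ (1 / q) := by positivity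
    have hSp : 0 < S ^ (1 - 2 / q) := by positivity
    field_simp
  calc ∑ i, ∑ j, b i ^ (1 - 1 / q) * b j ^ (1 - 1 / q) * w i j ^ (2 / q)
      ≤ ∑ i, ∑ j, L ^ (2 / q) * S ^ (1 - 2 / q) *
        (1 / q * (w i j * b i / L) + 1 / q * (w i j * b j / L) +
          (1 - 2 / q) * (b i * b j / S)) :=
        sum_le_sum fun i _ => sum_le_sum fun j _ => hterm i j
    _ = L ^ (2 / q) * S ^ (1 - 2 / q) *
        (1 / q * ((∑ i, (∑ j, w i j) * b i) / L) + 1 / q * ((∑ j, (∑ i, w i j) * b j) / L) +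
          (1 - 2 / q) * (S * S / S)) := by
        simp_rw [← mul_sum, sum_add_distrib, ← mul_sum, ← sum_div]
        rw [sum_comm (f := fun i j => w i j * b j)]
        simp_rw [← sum_mul, ← mul_sum, ← sum_mul, ← hS]
    _ ≤ L ^ (2 / q) * S ^ (1 - 2 / q) *
        (1 / q * ((∑ i, L * b i) / L) + 1 / q * ((∑ j, L * b j) / L) +
          (1 - 2 / q) * (S * S / S)) := by
        gcongr with i _ i _
        · exact hb i
        · exact hw1 i
        · exact hb i
        · exact hw2 i
    _ = L ^ (2 / q) * (S ^ (1 - 2 / q) * S) := by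
        rw [← mul_sum, ← hS, mul_div_cancel_left₀ _ hL.ne', mul_div_cancel_left₀ _ h0.ne']
        ring
    _ = L ^ (2 / q) * S ^ (2 - 2 / q) := by
        rw [← Real.rpow_add_one h0.ne']; congr 2; ring

/-- The `TT*` argument for finitely many times `i`. The numbers `n i` are the norms of the solution
at these times, written by duality as pairings `∑ k, c k * G i k`. -/
lemma sum_rpow_le_of_gram {I κ : Type*} [Fintype I] (Q : Finset κ) {q L B : ℝ} (hq : 2 ≤ q)
    (hL : 0 < L) (hB : 0 ≤ B) (n : I → ℝ) (hn : ∀ i, 0 ≤ n i) (c : κ → ℂ) (G : I → κ → ℂ)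
    (hG : ∀ i, (n i : ℂ) = ∑ k ∈ Q, c k * G i k)
    (w : I → I → ℝ) (hw : ∀ i j, 0 ≤ w i j) (hw1 : ∀ i, ∑ j, w i j ≤ L)
    (hw2 : ∀ j, ∑ i, w i j ≤ L)
    (hgram : ∀ i j, ‖∑ k ∈ Q, G i k * (starRingEnd ℂ) (G j k)‖ ≤ B * w i j ^ (2 / q)) :
    (∑ i, n i ^ q) ^ (2 / q) ≤ B * L ^ (2 / q) * ∑ k ∈ Q, ‖c k‖ ^ 2 := by
  have hq0 : 0 < q := by linarith
  set S := ∑ i, n i ^ q with hS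
  set V := ∑ k ∈ Q, ‖c k‖ ^ 2 with hV
  have hV0 : 0 ≤ V := sum_nonneg fun k _ => by positivity
  have hS0 : 0 ≤ S := sum_nonneg fun i _ => Real.rpow_nonneg (hn i) _
  rcases hS0.eq_or_lt with h0 | h0
  · rw [← h0, Real.zero_rpow (by positivity)]; positivity
  -- The dual exponents in time: `∑ i, a i * n i` is the sum to be estimated.
  set a : I → ℝ := fun i => n i ^ (q - 1) with ha
  have ha0 : ∀ i, 0 ≤ a i := fun i => Real.rpow_nonneg (hn i) _
  have han : ∀ i, a i * n i = n i ^ q := fun i => by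
    rcases (hn i).eq_or_lt with h | h
    · rw [← h, Real.zero_rpow hq0.ne', mul_zero]
    · rw [ha, ← Real.rpow_add_one h.ne', sub_add_cancel]
  have hab : ∀ i, a i = (n i ^ q) ^ (1 - 1 / q) := fun i => by
    rw [ha, ← Real.rpow_mul (hn i)]; field_simp
  have hSsum : (S : ℂ) = ∑ k ∈ Q, c k * ∑ i, (a i : ℂ) * G i k := by
    calc (S : ℂ) = ∑ i, (a i : ℂ) * (n i : ℂ) := by
          rw [hS]; push_cast
          exact sum_congr rfl fun i _ => by rw [← han i]; push_cast; ring
      _ = _ := by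
          simp_rw [hG, mul_sum]
          rw [sum_comm]
          exact sum_congr rfl fun k _ => sum_congr rfl fun i _ => by ring
  have hgram2 : ∑ k ∈ Q, ‖∑ i, (a i : ℂ) * G i k‖ ^ 2 ≤ B * (L ^ (2 / q) * S ^ (2 - 2 / q)) := by
    have h1 : ((∑ k ∈ Q, ‖∑ i, (a i : ℂ) * G i k‖ ^ 2 : ℝ) : ℂ) =
        ∑ i, ∑ j, (a i : ℂ) * a j * ∑ k ∈ Q, G i k * (starRingEnd ℂ) (G j k) := by
      push_cast
      simp_rw [← Complex.mul_conj', map_sum, sum_mul_sum, mul_sum]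
      rw [sum_comm]
      refine sum_congr rfl fun i _ => ?_
      rw [sum_comm]
      refine sum_congr rfl fun j _ => sum_congr rfl fun k _ => ?_
      rw [map_mul, Complex.conj_ofReal]
      ring
    have h2 : ∑ k ∈ Q, ‖∑ i, (a i : ℂ) * G i k‖ ^ 2 =
        ‖∑ i, ∑ j, (a i : ℂ) * a j * ∑ k ∈ Q, G i k * (starRingEnd ℂ) (G j k)‖ := by
      rw [← h1, Complex.norm_real, Real.norm_of_nonneg (sum_nonneg fun k _ => by positivity)]
    rw [h2]
    calc _ ≤ ∑ i, ∑ j, B * (a i * a j * w i j ^ (2 / q)) := by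
          refine (norm_sum_le _ _).trans (sum_le_sum fun i _ => (norm_sum_le _ _).trans
            (sum_le_sum fun j _ => ?_))
          rw [norm_mul, norm_mul, Complex.norm_real, Complex.norm_real,
            Real.norm_of_nonneg (ha0 i), Real.norm_of_nonneg (ha0 j)]
          calc _ ≤ a i * a j * (B * w i j ^ (2 / q)) :=
                mul_le_mul_of_nonneg_left (hgram i j) (mul_nonneg (ha0 i) (ha0 j))
            _ = _ := by ring
      _ = B * ∑ i, ∑ j, a i * a j * w i j ^ (2 / q) := by simp_rw [mul_sum]
      _ ≤ _ := by
          refine mul_le_mul_of_nonneg_left ?_ hB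
          simp_rw [hab]
          exact schur_test hq hL (fun i => n i ^ q) (fun i => Real.rpow_nonneg (hn i) _) w hw hw1
            hw2
  have hSle : S ≤ ∑ k ∈ Q, ‖c k‖ * ‖∑ i, (a i : ℂ) * G i k‖ := by
    calc S = ‖(S : ℂ)‖ := by rw [Complex.norm_real, Real.norm_of_nonneg hS0]
      _ ≤ _ := by
        rw [hSsum]
        refine (norm_sum_le _ _).trans (le_of_eq ?_)
        simp_rw [norm_mul]
  have hCS := sum_mul_sq_le_sq_mul_sq Q (fun k => ‖c k‖) fun k => ‖∑ i, (a i : ℂ) * G i k‖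
  have hS2 : S ^ 2 ≤ V * (B * (L ^ (2 / q) * S ^ (2 - 2 / q))) :=
    (pow_le_pow_left₀ hS0 hSle 2).trans (hCS.trans (mul_le_mul_of_nonneg_left hgram2 hV0))
  have hsplit : S ^ 2 = S ^ (2 / q) * S ^ (2 - 2 / q) := by
    rw [← Real.rpow_add h0, ← Real.rpow_natCast]; congr 1; push_cast; ring
  have hpos : 0 < S ^ (2 - 2 / q) := by positivity
  rw [hsplit] at hS2
  refine le_of_mul_le_mul_right (hS2.trans (le_of_eq ?_)) hpos
  ring

/-- Row sums of the kernel `1 / max 1 |i - j|` grow logarithmically. -/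
lemma sum_one_div_max_le (N : ℕ) (i : Fin N) :
    ∑ j : Fin N, 1 / max 1 |((i : ℕ) : ℝ) - (j : ℕ)| ≤ 3 + 2 * Real.log N := by
  have hN : 1 ≤ N := by have := i.2; omega
  have hi := i.2
  rw [Fin.sum_univ_eq_sum_range (fun j => 1 / max 1 |((i : ℕ) : ℝ) - (j : ℕ)|) N,
    ← sum_range_add_sum_Ico _ (show (i : ℕ) ≤ N by omega)]
  have hharm : ∀ n, n ≤ N → (∑ m ∈ range n, 1 / ((m : ℝ) + 1)) ≤ 1 + Real.log N := by
    intro n hn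
    rcases Nat.eq_zero_or_pos n with rfl | hn0
    · have := Real.log_natCast_nonneg N
      simpa using by linarith
    have h1 := harmonic_le_one_add_log n
    have h2 : ((harmonic n : ℚ) : ℝ) = ∑ m ∈ range n, 1 / ((m : ℝ) + 1) := by
      rw [harmonic]; push_cast
      exact sum_congr rfl fun m _ => by rw [one_div]
    rw [← h2]
    refine h1.trans ?_
    have : Real.log n ≤ Real.log N := Real.log_le_log (by exact_mod_cast hn0) (by exact_mod_cast hn)
    linarith
  have h1 : ∑ j ∈ range (i : ℕ), 1 / max 1 |((i : ℕ) : ℝ) - (j : ℕ)| ≤ 1 + Real.log N := by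
    rw [← sum_range_reflect]
    refine le_trans (le_of_eq (sum_congr rfl fun m hm => ?_)) (hharm i hi.le)
    rw [mem_range] at hm
    have : ((i : ℕ) : ℝ) - ((i - 1 - m : ℕ) : ℝ) = m + 1 := by
      rw [Nat.cast_sub (by omega), Nat.cast_sub (by omega)]; push_cast; ring
    rw [this, abs_of_nonneg (by positivity),
      max_eq_right (by linarith [Nat.cast_nonneg (α := ℝ) m])]
  have h2 : ∑ j ∈ Ico (i : ℕ) N, 1 / max 1 |((i : ℕ) : ℝ) - (j : ℕ)| ≤ 1 + (1 + Real.log N) := by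
    rw [sum_Ico_eq_sum_range, show N - i = (N - i - 1) + 1 by omega, sum_range_succ', add_comm]
    refine add_le_add (by simp) (le_trans (le_of_eq (sum_congr rfl fun m hm => ?_))
      (hharm (N - i - 1) (by omega)))
    have : ((i : ℕ) : ℝ) - ((i + (m + 1) : ℕ) : ℝ) = -(m + 1) := by push_cast; ring
    rw [this, abs_neg, abs_of_nonneg (by positivity),
      max_eq_right (by linarith [Nat.cast_nonneg (α := ℝ) m])]
  linarith

/-! ### Fourier analysis on the lattice -/

section OneDim

variable {M : ℕ} [NeZero M]

lemma exp_mesh_mul_two_mul (a : ℤ) :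
    Complex.exp (Complex.I * (mesh M * a : ℝ)) ^ (2 * M) = 1 := by
  rw [← Complex.exp_nat_mul]
  have h : ((2 * M : ℕ) : ℂ) * (Complex.I * (mesh M * a : ℝ)) = a * (2 * Real.pi * Complex.I) := by
    rw [← mesh_mul M]; push_cast; ring
  rw [h, Complex.exp_int_mul_two_pi_mul_I]

lemma exp_mesh_ne_one {a : ℤ} (ha0 : a ≠ 0) (ha : |a| < 2 * M) :
    Complex.exp (Complex.I * (mesh M * a : ℝ)) ≠ 1 := by
  intro h
  obtain ⟨n, hn⟩ := Complex.exp_eq_one_iff.1 h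
  have h1 : ((mesh M * a : ℝ) : ℂ) = ((n * (2 * Real.pi) : ℝ) : ℂ) := by
    apply mul_left_cancel₀ Complex.I_ne_zero
    rw [hn]; push_cast; ring
  have h2 : mesh M * a = n * (2 * Real.pi) := by exact_mod_cast h1
  rw [← mesh_mul M] at h2
  have h3 : (a : ℝ) = n * (2 * M) := mul_left_cancel₀ (mesh_pos M).ne' (by rw [h2]; ring)
  have h4 : a = n * (2 * M) := by exact_mod_cast h3
  rcases eq_or_ne n 0 with rfl | hn0
  · simp at h4; exact ha0 h4
  · have : 1 ≤ |n| := Int.one_le_abs hn0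
    rw [h4, abs_mul] at ha
    have h5 : |(2 * M : ℤ)| = 2 * M := abs_of_nonneg (by positivity)
    rw [h5] at ha
    nlinarith

lemma sum_range_exp_mesh {a : ℤ} (ha : |a| < 2 * M) :
    ∑ n ∈ range (2 * M), Complex.exp (Complex.I * (mesh M * a : ℝ)) ^ n =
      if a = 0 then (2 * M : ℂ) else 0 := by
  split_ifs with h0
  · simp [h0]
  · have h1 := mul_neg_geom_sum (Complex.exp (Complex.I * (mesh M * a : ℝ))) (2 * M)
    rw [exp_mesh_mul_two_mul, sub_self] at h1
    exact (mul_eq_zero.1 h1).resolve_left (sub_ne_zero.2 (exp_mesh_ne_one h0 ha).symm)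

lemma sum_zmod_eq_sum_range (f : ℕ → ℂ) :
    ∑ m : ZMod (2 * M), f m.val = ∑ n ∈ range (2 * M), f n := by
  refine sum_bij (fun m _ => m.val) (fun m _ => mem_range.2 (ZMod.val_lt m))
    (fun a _ b _ h => ZMod.val_injective _ h) (fun n hn => ⟨(n : ZMod (2 * M)), mem_univ _, ?_⟩)
    fun _ _ => rfl
  exact ZMod.val_cast_of_lt (mem_range.1 hn)

/-- Orthogonality of the one-dimensional characters. -/
lemma sum_zmod_exp {k l : ℤ} (hk : k ∈ Ico (-(M : ℤ)) M) (hl : l ∈ Ico (-(M : ℤ)) M) :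
    ∑ m : ZMod (2 * M), Complex.exp (Complex.I * ((k * (mesh M * (m.val : ℝ)) : ℝ) : ℂ)) *
        (starRingEnd ℂ) (Complex.exp (Complex.I * ((l * (mesh M * (m.val : ℝ)) : ℝ) : ℂ))) =
      if k = l then (2 * M : ℂ) else 0 := by
  rw [mem_Ico] at hk hl
  have h := sum_range_exp_mesh (M := M) (a := k - l) (by rw [abs_lt]; omega)
  rw [← sum_zmod_eq_sum_range] at h
  simp only [sub_eq_zero] at h
  rw [← h]
  refine sum_congr rfl fun m _ => ?_
  rw [← Complex.exp_conj, ← Complex.exp_add, ← Complex.exp_nat_mul]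
  congr 1
  generalize m.val = v
  simp
  ring

/-- Completeness of the one-dimensional characters. -/
lemma sum_freq_exp (m n : ZMod (2 * M)) :
    ∑ k ∈ Ico (-(M : ℤ)) M, Complex.exp (Complex.I * ((k * (mesh M * (m.val : ℝ)) : ℝ) : ℂ)) *
        (starRingEnd ℂ) (Complex.exp (Complex.I * ((k * (mesh M * (n.val : ℝ)) : ℝ) : ℂ))) =
      if m = n then (2 * M : ℂ) else 0 := by
  have hm := ZMod.val_lt m
  have hn := ZMod.val_lt n
  have h := sum_range_exp_mesh (M := M) (a := (m.val : ℤ) - n.val) (by rw [abs_lt]; omega)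
  have hiff : ((m.val : ℤ) - n.val = 0) ↔ m = n := by
    rw [sub_eq_zero, Nat.cast_inj]; exact (ZMod.val_injective _).eq_iff
  simp only [hiff] at h
  rw [sum_Ico_int_eq_sum_range]
  have h2 : ∀ j : ℕ, Complex.exp (Complex.I *
        ((((-(M : ℤ) + j : ℤ) : ℝ) * (mesh M * (m.val : ℝ)) : ℝ) : ℂ)) *
        (starRingEnd ℂ) (Complex.exp (Complex.I *
          ((((-(M : ℤ) + j : ℤ) : ℝ) * (mesh M * (n.val : ℝ)) : ℝ) : ℂ))) =
      Complex.exp (-(Complex.I * (M * (mesh M * ((m.val : ℝ) - n.val)) : ℝ))) *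
        Complex.exp (Complex.I * (mesh M * ((m.val : ℤ) - n.val : ℤ) : ℝ)) ^ j := by
    intro j
    rw [← Complex.exp_conj, ← Complex.exp_add, ← Complex.exp_nat_mul, ← Complex.exp_add]
    congr 1
    simp
    ring
  rw [sum_congr rfl fun j _ => h2 j, ← mul_sum, h]
  split_ifs with hmn
  · simp [hmn]
  · simp

lemma exp_val_add_one (a : ℤ) (m : ZMod (2 * M)) :
    Complex.exp (Complex.I * ((a * (mesh M * ((m + 1).val : ℝ)) : ℝ) : ℂ)) =
      Complex.exp (Complex.I * ((a * (mesh M * (m.val : ℝ)) : ℝ) : ℂ)) *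
        Complex.exp (Complex.I * ((mesh M * a : ℝ) : ℂ)) := by
  have hpow : ∀ n : ℕ, Complex.exp (Complex.I * ((a * (mesh M * (n : ℝ)) : ℝ) : ℂ)) =
      Complex.exp (Complex.I * (mesh M * a : ℝ)) ^ n := fun n => by
    rw [← Complex.exp_nat_mul]; congr 1; push_cast; ring
  have h1 := exp_mesh_mul_two_mul (M := M) a
  have hM := NeZero.ne M
  have : Fact (1 < 2 * M) := ⟨by omega⟩
  rw [hpow, hpow, ZMod.val_add, ZMod.val_one, ← pow_succ]
  conv_rhs => rw [← Nat.div_add_mod (m.val + 1) (2 * M), pow_add, pow_mul, h1, one_pow, one_mul]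

end OneDim

section Lattice

variable {M d : ℕ}

/-- The plane wave `x ↦ e^{i k · x}`. -/
noncomputable def wave (k : Fin d → ℤ) (x : Lattice M d) : ℂ :=
  Complex.exp (Complex.I * (pairing k x : ℂ))

lemma wave_eq_prod (k : Fin d → ℤ) (x : Lattice M d) :
    wave k x = ∏ j, Complex.exp (Complex.I * ((k j * (mesh M * ((x j).val : ℝ)) : ℝ) : ℂ)) := by
  rw [wave, ← Complex.exp_sum, pairing]
  simp only [coord]
  push_cast
  rw [mul_sum]

lemma conj_wave (k : Fin d → ℤ) (x : Lattice M d) :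
    (starRingEnd ℂ) (wave k x) = Complex.exp (-(Complex.I * (pairing k x : ℂ))) := by
  rw [wave, ← Complex.exp_conj]
  simp

variable [NeZero M]

lemma sum_wave_mul_conj {k l : Fin d → ℤ} (hk : k ∈ freqs M d) (hl : l ∈ freqs M d) :
    ∑ x : Lattice M d, wave k x * (starRingEnd ℂ) (wave l x) =
      if k = l then (2 * M : ℂ) ^ d else 0 := by
  rw [freqs, Fintype.mem_piFinset] at hk hl
  simp_rw [wave_eq_prod, map_prod, ← prod_mul_distrib]
  have h := Finset.prod_univ_sum (fun _ : Fin d => (univ : Finset (ZMod (2 * M))))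
    fun j m => Complex.exp (Complex.I * ((k j * (mesh M * (m.val : ℝ)) : ℝ) : ℂ)) *
        (starRingEnd ℂ) (Complex.exp (Complex.I * ((l j * (mesh M * (m.val : ℝ)) : ℝ) : ℂ)))
  rw [Fintype.piFinset_univ] at h
  rw [← h, prod_congr rfl fun j _ => sum_zmod_exp (hk j) (hl j)]
  split_ifs with hkl
  · simp [hkl]
  · obtain ⟨j, hj⟩ := Function.ne_iff.1 hkl
    exact prod_eq_zero (mem_univ j) (if_neg hj)

lemma sum_freqs_wave_mul_conj (x y : Lattice M d) :
    ∑ k ∈ freqs M d, wave k x * (starRingEnd ℂ) (wave k y) =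
      if x = y then (2 * M : ℂ) ^ d else 0 := by
  simp_rw [wave_eq_prod, map_prod, ← prod_mul_distrib]
  have h := Finset.prod_univ_sum (fun _ : Fin d => Ico (-(M : ℤ)) (M : ℤ))
    fun j k => Complex.exp (Complex.I * ((k * (mesh M * ((x j).val : ℝ)) : ℝ) : ℂ)) *
        (starRingEnd ℂ) (Complex.exp (Complex.I * ((k * (mesh M * ((y j).val : ℝ)) : ℝ) : ℂ)))
  rw [freqs, ← h, prod_congr rfl fun j _ => sum_freq_exp (x j) (y j)]
  split_ifs with hxy
  · simp [hxy]
  · obtain ⟨j, hj⟩ := Function.ne_iff.1 hxy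
    exact prod_eq_zero (mem_univ j) (if_neg hj)

lemma wave_add_single (k : Fin d → ℤ) (x : Lattice M d) (j : Fin d) :
    wave k (x + Pi.single j 1) = wave k x * Complex.exp (Complex.I * ((mesh M * k j : ℝ) : ℂ)) := by
  classical
  rw [wave_eq_prod, wave_eq_prod, ← mul_prod_erase _ _ (mem_univ j),
    ← mul_prod_erase univ (fun i => Complex.exp (Complex.I *
      ((k i * (mesh M * ((x i).val : ℝ)) : ℝ) : ℂ))) (mem_univ j)]
  rw [Pi.add_apply, Pi.single_eq_same, exp_val_add_one, mul_right_comm]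
  congr 1
  congr 1
  refine prod_congr rfl fun i hi => ?_
  rw [Pi.add_apply, Pi.single_eq_of_ne (ne_of_mem_erase hi), add_zero]

/-- The symbol of `-Δ_h`. -/
noncomputable def symbol (M : ℕ) {d : ℕ} (k : Fin d → ℤ) : ℝ := ∑ j, dispersion M (k j)

lemma laplacian_wave (k : Fin d → ℤ) :
    laplacian M d (wave k) = (-(symbol M k : ℂ)) • wave k := by
  funext x
  have hh : (mesh M : ℂ) ≠ 0 := by exact_mod_cast (mesh_pos M).ne'
  have hsub : ∀ j, wave k (x - Pi.single j 1) =
      wave k x * Complex.exp (-(Complex.I * ((mesh M * k j : ℝ) : ℂ))) := fun j => by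
    have h := wave_add_single k (x - Pi.single j 1) j
    rw [sub_add_cancel] at h
    rw [h, mul_assoc, ← Complex.exp_add, add_neg_cancel, Complex.exp_zero, mul_one]
  simp only [laplacian, LinearMap.coe_mk, AddHom.coe_mk, Pi.smul_apply, smul_eq_mul, symbol,
    hsub, wave_add_single]
  push_cast
  rw [← sum_neg_distrib, sum_mul]
  refine sum_congr rfl fun j _ => ?_
  have h1 : Complex.exp (Complex.I * (mesh M * k j)) + Complex.exp (-(Complex.I * (mesh M * k j))) =
      2 * Complex.cos (mesh M * k j) := by
    rw [Complex.two_cos]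
    congr 1 <;> congr 1 <;> ring
  rw [dispersion]
  push_cast
  generalize Complex.exp (Complex.I * (mesh M * k j)) = e₁ at h1 ⊢
  generalize Complex.exp (-(Complex.I * (mesh M * k j))) = e₂ at h1 ⊢
  field_simp
  linear_combination (wave k x) * h1

lemma exp_apply_eigenvector {E : Type*} [NormedAddCommGroup E] [NormedSpace ℂ E] [CompleteSpace E]
    (A : E →L[ℂ] E) {v : E} {lam : ℂ} (h : A v = lam • v) :
    NormedSpace.exp A v = Complex.exp lam • v := by
  have hpow : ∀ n : ℕ, (A ^ n) v = lam ^ n • v := fun n => by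
    induction n with
    | zero => simp
    | succ n ih => rw [pow_succ, mul_apply_eq_comp, h, map_smul, ih, smul_smul, pow_succ,
        mul_comm]
  have h1 := (NormedSpace.exp_series_hasSum_exp' (𝕂 := ℂ) A).mapL
    (ContinuousLinearMap.apply ℂ E v)
  have h2 := (NormedSpace.exp_series_hasSum_exp' (𝕂 := ℂ) lam).smul_const v
  rw [Complex.exp_eq_exp_ℂ]
  refine h1.unique (h2.congr_fun ?_)
  intro n
  simp [hpow, smul_smul]

lemma propagator_wave (t : ℝ) (k : Fin d → ℤ) :
    propagator M d t (wave k) =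
      Complex.exp (-(Complex.I * ((t * symbol M k : ℝ) : ℂ))) • wave k := by
  have h : ((Complex.I * (t : ℂ)) • (laplacian M d).toContinuousLinearMap) (wave k) =
      (-(Complex.I * ((t * symbol M k : ℝ) : ℂ))) • wave k := by
    rw [smul_apply, LinearMap.coe_toContinuousLinearMap', laplacian_wave,
      smul_smul]
    congr 1
    push_cast; ring
  exact exp_apply_eigenvector _ h

/-- A trigonometric polynomial with frequencies in `Q`. -/
noncomputable def trigPoly (Q : Finset (Fin d → ℤ)) (c : (Fin d → ℤ) → ℂ) : Lattice M d → ℂ :=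
  fun x => ∑ k ∈ Q, c k * wave k x

omit [NeZero M] in
lemma trigPoly_eq_sum (Q : Finset (Fin d → ℤ)) (c : (Fin d → ℤ) → ℂ) :
    (trigPoly Q c : Lattice M d → ℂ) = ∑ k ∈ Q, c k • wave k := by
  funext x
  simp [trigPoly, Finset.sum_apply]

lemma propagator_trigPoly (t : ℝ) (Q : Finset (Fin d → ℤ)) (c : (Fin d → ℤ) → ℂ) :
    propagator M d t (trigPoly Q c) =
      trigPoly Q fun k => c k * Complex.exp (-(Complex.I * ((t * symbol M k : ℝ) : ℂ))) := by
  simp_rw [trigPoly_eq_sum, map_sum, map_smul, propagator_wave, smul_smul]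

/-- The Fourier coefficients of `u`, normalized so that `u` is their trigonometric polynomial. -/
noncomputable def coeff (u : Lattice M d → ℂ) (k : Fin d → ℤ) : ℂ :=
  1 / (2 * (Real.pi : ℂ)) ^ d * latticeFourier u k

lemma trigPoly_coeff (u : Lattice M d → ℂ) : trigPoly (freqs M d) (coeff u) = u := by
  classical
  funext x
  have hM : (M : ℂ) ≠ 0 := by exact_mod_cast NeZero.ne M
  have hpi : (Real.pi : ℂ) ≠ 0 := by exact_mod_cast Real.pi_ne_zero
  have h1 : trigPoly (freqs M d) (coeff u) x = ∑ y, 1 / (2 * (Real.pi : ℂ)) ^ d * mesh M ^ d *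
      u y * ∑ k ∈ freqs M d, wave k x * (starRingEnd ℂ) (wave k y) := by
    simp_rw [trigPoly, coeff, latticeFourier, mul_sum, sum_mul, conj_wave]
    rw [sum_comm]
    refine sum_congr rfl fun y _ => sum_congr rfl fun k _ => ?_
    ring
  rw [h1]
  simp_rw [sum_freqs_wave_mul_conj]
  simp only [mul_ite, mul_zero, sum_ite_eq, mem_univ, if_true]
  rw [mesh]
  push_cast
  rw [div_pow, mul_pow, mul_pow]
  field_simp

lemma fracDeriv_eq_trigPoly (s : ℝ) (u : Lattice M d → ℂ) :
    fracDeriv s u = trigPoly (freqs M d) fun k => ((bracket k ^ s : ℝ) : ℂ) * coeff u k := by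
  funext x
  rw [fracDeriv, latticeFourierInv, trigPoly, mul_sum]
  refine sum_congr rfl fun k _ => ?_
  rw [coeff, wave]; ring

/-- Parseval's identity. -/
lemma sum_norm_trigPoly_sq {Q : Finset (Fin d → ℤ)} (hQ : Q ⊆ freqs M d) (c : (Fin d → ℤ) → ℂ) :
    ∑ x : Lattice M d, ‖trigPoly Q c x‖ ^ 2 = (2 * M : ℝ) ^ d * ∑ k ∈ Q, ‖c k‖ ^ 2 := by
  classical
  have h : ((∑ x : Lattice M d, ‖trigPoly Q c x‖ ^ 2 : ℝ) : ℂ) =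
      (((2 * M : ℝ) ^ d * ∑ k ∈ Q, ‖c k‖ ^ 2 : ℝ) : ℂ) := by
    push_cast
    simp_rw [← Complex.mul_conj', trigPoly, map_sum, sum_mul_sum, mul_sum]
    rw [sum_comm]
    refine sum_congr rfl fun k hk => ?_
    rw [sum_comm]
    have h1 : ∀ l ∈ Q, ∑ x : Lattice M d, c k * wave k x * (starRingEnd ℂ) (c l * wave l x) =
        if k = l then (2 * M : ℂ) ^ d * (c k * (starRingEnd ℂ) (c k)) else 0 := by
      intro l hl
      have h2 := sum_wave_mul_conj (hQ hk) (hQ hl)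
      calc _ = c k * (starRingEnd ℂ) (c l) *
            ∑ x : Lattice M d, wave k x * (starRingEnd ℂ) (wave l x) := by
            rw [mul_sum]
            exact sum_congr rfl fun x _ => by rw [map_mul]; ring
        _ = _ := by
            rw [h2]
            split_ifs with hkl
            · subst hkl; ring
            · simp
    rw [sum_congr rfl h1]
    simp [hk]
  exact_mod_cast h

/-- Bessel's inequality, dual to Parseval's identity. -/
lemma sum_norm_sum_wave_sq_le {Q : Finset (Fin d → ℤ)} (hQ : Q ⊆ freqs M d)
    (f : Lattice M d → ℂ) :
    ∑ k ∈ Q, ‖∑ x, f x * wave k x‖ ^ 2 ≤ (2 * M : ℝ) ^ d * ∑ x, ‖f x‖ ^ 2 := by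
  set T := ∑ k ∈ Q, ‖∑ x, f x * wave k x‖ ^ 2 with hT
  have hT0 : 0 ≤ T := sum_nonneg fun k _ => by positivity
  rcases hT0.eq_or_lt with h0 | h0
  · rw [← h0]; positivity
  set a : (Fin d → ℤ) → ℂ := fun k => (starRingEnd ℂ) (∑ x, f x * wave k x) with ha
  have h1 : (T : ℂ) = ∑ x, f x * trigPoly Q a x := by
    rw [hT]
    push_cast
    simp_rw [← Complex.mul_conj', trigPoly, mul_sum]
    rw [sum_comm]
    refine sum_congr rfl fun k _ => ?_
    rw [sum_mul]
    exact sum_congr rfl fun x _ => by rw [ha]; ring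
  have h2 : T ≤ ∑ x, ‖f x‖ * ‖trigPoly Q a x‖ := by
    calc T = ‖(T : ℂ)‖ := by rw [Complex.norm_real, Real.norm_of_nonneg hT0]
      _ ≤ _ := by
        rw [h1]
        refine (norm_sum_le _ _).trans (le_of_eq ?_)
        simp_rw [norm_mul]
  have h3 := sum_mul_sq_le_sq_mul_sq univ (fun x => ‖f x‖) fun x => ‖trigPoly (M := M) Q a x‖
  rw [sum_norm_trigPoly_sq hQ] at h3
  have h4 : ∑ k ∈ Q, ‖a k‖ ^ 2 = T := sum_congr rfl fun k _ => by rw [ha, Complex.norm_conj]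
  rw [h4] at h3
  have h5 := (pow_le_pow_left₀ hT0 h2 2).trans h3
  rw [sq] at h5
  refine le_of_mul_le_mul_right (h5.trans (le_of_eq ?_)) h0
  ring

/-- Plancherel's theorem for the norm of `L^2_h`. -/
lemma latticeNorm_two_trigPoly {Q : Finset (Fin d → ℤ)} (hQ : Q ⊆ freqs M d)
    (c : (Fin d → ℤ) → ℂ) :
    latticeNorm 2 (trigPoly Q c : Lattice M d → ℂ) =
      √((2 * Real.pi) ^ d * ∑ k ∈ Q, ‖c k‖ ^ 2) := by
  have h := sum_norm_trigPoly_sq hQ c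
  rw [latticeNorm, if_neg (by simp), Real.sqrt_eq_rpow]
  simp only [ENNReal.toReal_ofNat, Real.rpow_ofNat]
  rw [h, ← mul_assoc, ← mul_pow, ← mesh_mul M]
  congr 3
  ring

end Lattice

/-! ### The Strichartz estimate at discrete times -/

section Block

variable {M d : ℕ}

/-- The space-time plane wave `e^{i k · x - i t Φ(k)}`. -/
noncomputable def evolvedWave (t : ℝ) (x : Lattice M d) (k : Fin d → ℤ) : ℂ :=
  Complex.exp (-(Complex.I * ((t * symbol M k : ℝ) : ℂ))) * wave k x

/-- The kernel of the propagator on a cube factors over the coordinates. -/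
lemma sum_evolvedWave_mul_conj (N : ℕ) (t t' : ℝ) (x y : Lattice M d) :
    ∑ k ∈ freqs N d, evolvedWave t x k * (starRingEnd ℂ) (evolvedWave t' y k) =
      ∏ j, kernel M N (t - t') (coord x j - coord y j) := by
  simp_rw [kernel]
  rw [freqs, Finset.prod_univ_sum]
  refine sum_congr rfl fun k _ => ?_
  rw [← Complex.exp_sum, evolvedWave, evolvedWave, map_mul, conj_wave, ← Complex.exp_conj, wave,
    ← Complex.exp_add, ← Complex.exp_add, ← Complex.exp_add]
  congr 1
  simp only [map_neg, map_mul, Complex.conj_I, Complex.conj_ofReal, kernelPhase, symbol, pairing]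
  push_cast
  rw [← mul_sum, sum_sub_distrib, ← mul_sum]
  simp_rw [mul_sub, sum_sub_distrib]
  ring

lemma freqs_mono {N M : ℕ} (h : N ≤ M) (d : ℕ) : freqs N d ⊆ freqs M d := by
  intro k hk
  rw [freqs, Fintype.mem_piFinset] at hk ⊢
  intro j
  have := hk j
  simp only [mem_Ico] at this ⊢
  omega

variable [NeZero M]

lemma sum_norm_sum_evolvedWave_sq_le {Q : Finset (Fin d → ℤ)} (hQ : Q ⊆ freqs M d) (t : ℝ)
    (f : Lattice M d → ℂ) :
    ∑ k ∈ Q, ‖∑ x, f x * evolvedWave t x k‖ ^ 2 ≤ (2 * M : ℝ) ^ d * ∑ x, ‖f x‖ ^ 2 := by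
  refine le_trans (le_of_eq (sum_congr rfl fun k _ => ?_)) (sum_norm_sum_wave_sq_le hQ f)
  have : ∑ x, f x * evolvedWave t x k =
      Complex.exp (((-(t * symbol M k) : ℝ) : ℂ) * Complex.I) * ∑ x, f x * wave k x := by
    rw [mul_sum]
    refine sum_congr rfl fun x _ => ?_
    rw [evolvedWave, mul_left_comm]
    congr 2
    push_cast; ring
  rw [this, norm_mul, Complex.norm_exp_ofReal_mul_I, one_mul]

/-- The interpolated dispersive estimate, for the `TT*` form of the evolution from frequencies in
the cube to functions at time `t`. Here `g` and `g'` are in the unit ball of `ℓ^p`, with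
`1 / p = 1 - θ / 2`; the kernel bound enters at `θ = 0` and Bessel's inequality at `θ = 1`. -/
lemma norm_gram_le {N : ℕ} (hNM : N ≤ M) {t t' θ p A : ℝ} (hθ0 : 0 ≤ θ) (hθ1 : θ ≤ 1)
    (hp : p * (1 - θ / 2) = 1) (hA : 0 ≤ A) (hker : ∀ x, ‖kernel M N (t - t') x‖ ≤ A)
    (g g' : Lattice M d → ℂ) (hg : ∑ x, ‖g x‖ ^ p ≤ 1) (hg' : ∑ x, ‖g' x‖ ^ p ≤ 1) :
    ‖∑ k ∈ freqs N d, (∑ x, g x * evolvedWave t x k) *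
        (starRingEnd ℂ) (∑ y, g' y * evolvedWave t' y k)‖ ≤
      (A ^ d) ^ (1 - θ) * ((2 * M : ℝ) ^ d) ^ θ := by
  have hswap : ∀ f f' : Lattice M d → ℂ,
      ∑ x, ∑ y, (∑ k ∈ freqs N d, evolvedWave t x k * (starRingEnd ℂ) (evolvedWave t' y k)) *
        f x * f' y =
      ∑ k ∈ freqs N d, (∑ x, f x * evolvedWave t x k) *
        ∑ y, f' y * (starRingEnd ℂ) (evolvedWave t' y k) := by
    intro f f'
    simp_rw [sum_mul_sum, sum_mul]
    conv_rhs => rw [sum_comm]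
    refine sum_congr rfl fun x _ => ?_
    rw [sum_comm]
    exact sum_congr rfl fun k _ => sum_congr rfl fun y _ => by ring
  have h := norm_bilin_le_of_sum_le_one
    (fun x y : Lattice M d =>
      ∑ k ∈ freqs N d, evolvedWave t x k * (starRingEnd ℂ) (evolvedWave t' y k))
    (A := A ^ d) (B := (2 * M : ℝ) ^ d) hθ0 hθ1 hp (by positivity) (by positivity)
    (fun x y => ?_) (fun f f' => ?_) g (fun y => (starRingEnd ℂ) (g' y)) hg
    (by simpa only [Complex.norm_conj] using hg')
  · rw [hswap] at h
    simpa only [map_sum, map_mul] using h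
  · rw [sum_evolvedWave_mul_conj, norm_prod]
    calc _ ≤ ∏ _j : Fin d, A := prod_le_prod (fun _ _ => norm_nonneg _) fun _ _ => hker _
      _ = A ^ d := by simp
  · rw [hswap]
    set D : ℝ := (2 * M : ℝ) ^ d with hD
    have e1 := sum_norm_sum_evolvedWave_sq_le (freqs_mono hNM d) t f
    have e2 := sum_norm_sum_evolvedWave_sq_le (freqs_mono hNM d) t' fun y => (starRingEnd ℂ) (f' y)
    have e3 : ∀ k, ‖∑ y, f' y * (starRingEnd ℂ) (evolvedWave t' y k)‖ =
        ‖∑ y, (starRingEnd ℂ) (f' y) * evolvedWave t' y k‖ := fun k => by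
      rw [← Complex.norm_conj]
      simp only [map_sum, map_mul, Complex.conj_conj]
    simp only [Complex.norm_conj] at e2
    calc _ ≤ ∑ k ∈ freqs N d, ‖∑ x, f x * evolvedWave t x k‖ *
          ‖∑ y, f' y * (starRingEnd ℂ) (evolvedWave t' y k)‖ := by
          refine (norm_sum_le _ _).trans (le_of_eq ?_)
          simp_rw [norm_mul]
      _ ≤ √(∑ k ∈ freqs N d, ‖∑ x, f x * evolvedWave t x k‖ ^ 2) *
          √(∑ k ∈ freqs N d, ‖∑ y, f' y * (starRingEnd ℂ) (evolvedWave t' y k)‖ ^ 2) :=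
          Real.sum_mul_le_sqrt_mul_sqrt _ _ _
      _ ≤ √(D * ∑ x, ‖f x‖ ^ 2) * √(D * ∑ x, ‖f' x‖ ^ 2) := by
          simp_rw [e3]
          gcongr
      _ = D * √(∑ x, ‖f x‖ ^ 2) * √(∑ x, ‖f' x‖ ^ 2) := by
          rw [Real.sqrt_mul (by positivity), Real.sqrt_mul (by positivity)]
          have : √D * √D = D := Real.mul_self_sqrt (by positivity)
          linear_combination (√(∑ x, ‖f x‖ ^ 2) * √(∑ x, ‖f' x‖ ^ 2)) * this

/-- Duality for the norm of `L^r_h`, against the unit ball of `ℓ^p` for the dual exponent `p`. -/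
lemma exists_dual_latticeNorm {r : ℝ≥0∞} (hr : 2 ≤ r) {p : ℝ}
    (hp : p * (1 - (2 / r).toReal / 2) = 1) (F : Lattice M d → ℂ) :
    ∃ g : Lattice M d → ℂ, ∑ x, ‖g x‖ ^ p ≤ 1 ∧
      ((latticeNorm r F : ℝ) : ℂ) =
        (((mesh M ^ d) ^ ((2 / r).toReal / 2) : ℝ) : ℂ) * ∑ x, F x * g x := by
  have hmesh := mesh_pos M
  by_cases hr' : r = ∞
  · have hp1 : p = 1 := by simpa [hr'] using hp
    obtain ⟨g, hg, hFg⟩ := exists_dual_top F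
    refine ⟨g, by rwa [hp1], ?_⟩
    rw [hFg, latticeNorm, if_pos hr', hr']
    simp
  · have hr2 : 2 ≤ r.toReal := by
      have := ENNReal.toReal_mono hr' hr
      simpa using this
    have hθ : (2 / r).toReal / 2 = 1 / r.toReal := by
      rw [ENNReal.toReal_div, ENNReal.toReal_ofNat]; ring
    rw [hθ] at hp ⊢
    have hp0 : p ≠ 0 := by rintro rfl; simp at hp
    obtain ⟨g, hg, hFg⟩ := exists_dual_finite (r := r.toReal) (p := p) (by linarith)
      (by field_simp at hp ⊢; linarith) F
    refine ⟨g, hg, ?_⟩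
    rw [hFg, latticeNorm, if_neg hr', ← Complex.ofReal_mul, ← Real.mul_rpow (by positivity)
      (sum_nonneg fun x _ => by positivity)]

lemma latticeNorm_nonneg (r : ℝ≥0∞) (f : Lattice M d → ℂ) : 0 ≤ latticeNorm r f := by
  have := mesh_pos M
  rw [latticeNorm]
  split_ifs
  · exact Real.iSup_nonneg fun x => norm_nonneg _
  · positivity

/-- The Strichartz estimate for frequencies in a cube of side `2 N`, on `N` times of spacing
`1 / N ^ 2`. On such a set of times the kernel bound is of the form `(N ^ 3 / |i - j|) ^ (1 / 3)`
in each variable, so that the Schur test loses only a logarithm. -/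
lemma sum_latticeNorm_rpow_le {N : ℕ} (hN : 1 ≤ N) (hNM : N ≤ M) {r : ℝ≥0∞} (hr : 2 ≤ r) {q : ℝ}
    (hq : 2 ≤ q) (hqr : d * (1 - (2 / r).toReal) = 6 / q) (c : (Fin d → ℤ) → ℂ) (s : ℝ) :
    ∑ i ∈ range N, latticeNorm r (propagator M d (s + i * (1 / (N : ℝ) ^ 2))
        (trigPoly (freqs N d) c)) ^ q ≤
      180 ^ 3 * N ^ 3 * (3 + 2 * Real.log N) *
        latticeNorm 2 (trigPoly (freqs N d) c : Lattice M d → ℂ) ^ q := by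
  have hmesh := mesh_pos M
  have hN' : (1 : ℝ) ≤ N := by exact_mod_cast hN
  have hq0 : 0 < q := by linarith
  set θ : ℝ := (2 / r).toReal with hθ
  have hθ0 : 0 ≤ θ := ENNReal.toReal_nonneg
  have hθ1 : θ ≤ 1 := by
    have : 2 / r ≤ 1 := ENNReal.div_le_of_le_mul (by simpa using hr)
    rw [hθ, ← ENNReal.toReal_one]
    exact ENNReal.toReal_mono ENNReal.one_ne_top this
  set p : ℝ := (1 - θ / 2)⁻¹ with hpdef
  have hp : p * (1 - θ / 2) = 1 := inv_mul_cancel₀ (by linarith)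
  set L : ℝ := 3 + 2 * Real.log N with hL
  have hL0 : 0 < L := by have := Real.log_nonneg hN'; positivity
  set H : ℝ := mesh M ^ d with hH
  have hH0 : 0 < H := by positivity
  set τ : ℕ → ℝ := fun i => s + i * (1 / (N : ℝ) ^ 2) with hτ
  set n : Fin N → ℝ := fun i =>
    latticeNorm r (propagator M d (τ i) (trigPoly (freqs N d) c)) with hn
  choose g hg hFg using fun i : Fin N =>
    exists_dual_latticeNorm hr hp (propagator M d (τ i) (trigPoly (freqs N d) c))
  set V : ℝ := ∑ k ∈ freqs N d, ‖c k‖ ^ 2 with hV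
  set D : ℝ := (2 * M : ℝ) ^ d with hD
  set w : Fin N → Fin N → ℝ := fun i j => 1 / max 1 |((i : ℕ) : ℝ) - (j : ℕ)| with hw
  have hker : ∀ i j : Fin N, ∀ x, ‖kernel M N (τ i - τ j) x‖ ≤ 180 * N * w i j ^ (1 / 3 : ℝ) := by
    intro i j x
    rcases eq_or_ne i j with rfl | hij
    · refine (norm_kernel_le_trivial M N _ x).trans ?_
      simp only [hw, sub_self, abs_zero, zero_le_one, max_eq_left, div_one, Real.one_rpow]
      linarith
    · have h1 : τ i - τ j = (((i : ℕ) : ℝ) - (j : ℕ)) / N ^ 2 := by rw [hτ]; ring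
      have hne : (((i : ℕ) : ℤ) - (j : ℕ)) ≠ 0 := by
        have : (i : ℕ) ≠ j := fun h => hij (Fin.ext h)
        omega
      have h2 : (1 : ℝ) ≤ |((i : ℕ) : ℝ) - (j : ℕ)| := by
        have := Int.one_le_abs hne
        exact_mod_cast this
      have h3 : |((i : ℕ) : ℝ) - (j : ℕ)| ≤ N := by
        have h4 : |((i : ℕ) : ℤ) - (j : ℕ)| ≤ N := by
          have := i.2; have := j.2
          rw [abs_le]; omega
        exact_mod_cast h4
      set m : ℝ := |((i : ℕ) : ℝ) - (j : ℕ)| with hm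
      have h5 : |τ i - τ j| = m / N ^ 2 := by
        rw [h1, abs_div, abs_of_nonneg (show (0 : ℝ) ≤ N ^ 2 by positivity)]
      have h6 := norm_kernel_le (M := M) hN hNM (t := τ i - τ j) x
        (by rw [← abs_pos, h5]; positivity)
        (by rw [h5, div_le_div_iff₀ (by positivity) (by positivity)]; nlinarith)
      refine h6.trans (le_of_eq ?_)
      have h7 : (N : ℝ) / |τ i - τ j| = N ^ 3 * (1 / m) := by rw [h5]; field_simp
      have h8 : ((N : ℝ) ^ 3) ^ (1 / 3 : ℝ) = N := by
        rw [← Real.rpow_natCast, ← Real.rpow_mul (by positivity)]; norm_num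
      rw [h7, Real.mul_rpow (by positivity) (by positivity), h8]
      simp only [hw, max_eq_right h2, ← hm]
      ring
  have hw0 : ∀ i j, 0 ≤ w i j := fun i j => by simp only [hw]; positivity
  have hgram : ∀ i j : Fin N, ‖∑ k ∈ freqs N d,
      (((H ^ (θ / 2) : ℝ) : ℂ) * ∑ x, g i x * evolvedWave (τ i) x k) *
        (starRingEnd ℂ) (((H ^ (θ / 2) : ℝ) : ℂ) * ∑ x, g j x * evolvedWave (τ j) x k)‖ ≤
      ((180 * N) ^ (6 / q) * (H * D) ^ θ) * w i j ^ (2 / q) := by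
    intro i j
    have hwp : 0 ≤ w i j ^ (1 / 3 : ℝ) := Real.rpow_nonneg (hw0 i j) _
    have h := norm_gram_le hNM hθ0 hθ1 hp (by positivity) (hker i j) (g i) (g j) (hg i) (hg j)
    have h1 : ∑ k ∈ freqs N d,
      (((H ^ (θ / 2) : ℝ) : ℂ) * ∑ x, g i x * evolvedWave (τ i) x k) *
        (starRingEnd ℂ) (((H ^ (θ / 2) : ℝ) : ℂ) * ∑ x, g j x * evolvedWave (τ j) x k) =
        ((H ^ θ : ℝ) : ℂ) * ∑ k ∈ freqs N d, (∑ x, g i x * evolvedWave (τ i) x k) *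
        (starRingEnd ℂ) (∑ x, g j x * evolvedWave (τ j) x k) := by
      have h2 : H ^ θ = H ^ (θ / 2) * H ^ (θ / 2) := by
        rw [← Real.rpow_add hH0]; congr 1; ring
      rw [mul_sum, h2]
      refine sum_congr rfl fun k _ => ?_
      rw [map_mul, Complex.conj_ofReal]
      push_cast
      ring
    rw [h1, norm_mul, Complex.norm_real, Real.norm_of_nonneg (by positivity)]
    refine (mul_le_mul_of_nonneg_left h (by positivity)).trans (le_of_eq ?_)
    rw [← Real.rpow_natCast (180 * N * w i j ^ (1 / 3 : ℝ)), ← Real.rpow_mul (by positivity), hqr,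
      Real.mul_rpow (by positivity) hwp, ← Real.rpow_mul (hw0 i j),
      Real.mul_rpow hH0.le (by positivity), show (1 / 3 : ℝ) * (6 / q) = 2 / q by ring]
    ring
  have hsum := sum_rpow_le_of_gram (freqs N d) hq hL0 (B := (180 * N) ^ (6 / q) * (H * D) ^ θ)
    (by positivity) n
    (fun i => latticeNorm_nonneg _ _) c
    (fun i k => ((H ^ (θ / 2) : ℝ) : ℂ) * ∑ x, g i x * evolvedWave (τ i) x k)
    (fun i => by
      simp only [hn]
      rw [hFg i, propagator_trigPoly]
      simp_rw [trigPoly, sum_mul, mul_sum]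
      rw [sum_comm]
      refine sum_congr rfl fun k _ => sum_congr rfl fun x _ => ?_
      rw [evolvedWave]
      ring)
    w hw0 (fun i => sum_one_div_max_le N i)
    (fun j => by
      have := sum_one_div_max_le N j
      simp only [hw]
      simp_rw [abs_sub_comm (((j : ℕ) : ℝ))] at this
      exact this)
    hgram
  have hHD : H * D = (2 * Real.pi) ^ d := by
    rw [hH, hD, ← mul_pow, ← mesh_mul M]; ring
  have h2pi : (1 : ℝ) ≤ (2 * Real.pi) ^ d := one_le_pow₀ (by linarith [Real.pi_gt_three])
  have hV0 : 0 ≤ V := sum_nonneg fun k _ => by positivity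
  have hpl := latticeNorm_two_trigPoly (freqs_mono hNM d) c
  set U : ℝ := latticeNorm 2 (trigPoly (freqs N d) c : Lattice M d → ℂ) with hU
  have hU0 : 0 ≤ U := by rw [hpl]; positivity
  have hU2 : U ^ 2 = (2 * Real.pi) ^ d * V := by rw [hpl, Real.sq_sqrt (by positivity)]
  have hn0 : 0 ≤ ∑ i, n i ^ q :=
    sum_nonneg fun i _ => Real.rpow_nonneg (latticeNorm_nonneg _ _) _
  have hfin : (∑ i, n i ^ q) ^ (2 / q) ≤ (180 * N) ^ (6 / q) * L ^ (2 / q) * U ^ 2 := by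
    refine hsum.trans ?_
    rw [hHD, hU2]
    have : ((2 * Real.pi) ^ d) ^ θ ≤ (2 * Real.pi) ^ d := by
      calc ((2 * Real.pi) ^ d) ^ θ ≤ ((2 * Real.pi) ^ d) ^ (1 : ℝ) :=
            Real.rpow_le_rpow_of_exponent_le h2pi hθ1
        _ = _ := Real.rpow_one _
    calc (180 * N) ^ (6 / q) * ((2 * Real.pi) ^ d) ^ θ * L ^ (2 / q) * V
        ≤ (180 * N) ^ (6 / q) * (2 * Real.pi) ^ d * L ^ (2 / q) * V := by gcongr
      _ = _ := by ring
  have hroot := Real.rpow_le_rpow (by positivity) hfin (show 0 ≤ q / 2 by positivity)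
  rw [← Real.rpow_mul hn0, show 2 / q * (q / 2) = 1 by field_simp, Real.rpow_one,
    Real.mul_rpow (by positivity) (by positivity), Real.mul_rpow (by positivity) (by positivity),
    ← Real.rpow_mul (by positivity), ← Real.rpow_mul hL0.le,
    show 2 / q * (q / 2) = 1 by field_simp,
    show 6 / q * (q / 2) = (3 : ℕ) by push_cast; field_simp; norm_num,
    Real.rpow_natCast, Real.rpow_one, ← Real.rpow_natCast U, ← Real.rpow_mul hU0, mul_pow,
    show ((2 : ℕ) : ℝ) * (q / 2) = q by push_cast; ring] at hroot
  rw [← Fin.sum_univ_eq_sum_range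
    (fun i => latticeNorm r (propagator M d (τ i) (trigPoly (freqs N d) c)) ^ q) N]
  exact hroot

end Block

/-! ### From discrete times to the unit interval -/

/-- An integral over `n` adjacent intervals of length `δ`, folded onto the first one. -/
lemma setLIntegral_Icc_le_sum (φ : ℝ → ℝ≥0∞) (n : ℕ) {δ : ℝ} (hδ : 0 ≤ δ) :
    ∫⁻ t in Set.Icc 0 (n * δ), φ t ≤ ∑ j ∈ range n, ∫⁻ s in Set.Icc 0 δ, φ (j * δ + s) := by
  induction n with
  | zero => simp
  | succ n ih =>
    have hshift : ∫⁻ t in Set.Icc (n * δ) (n * δ + δ), φ t =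
        ∫⁻ s in Set.Icc 0 δ, φ (n * δ + s) := by
      rw [← (measurePreserving_add_left volume ((n : ℝ) * δ)).setLIntegral_comp_preimage_emb
        (measurableEmbedding_addLeft _)]
      simp
    rw [sum_range_succ, ← hshift]
    refine le_trans (lintegral_mono_set (t := Set.Icc 0 (n * δ) ∪ Set.Icc (n * δ) (n * δ + δ)) ?_)
      ((lintegral_union_le _ _ _).trans (add_le_add_left ih _))
    rw [Set.Icc_union_Icc_eq_Icc (by positivity) (by linarith)]
    refine Set.Icc_subset_Icc_right (le_of_eq ?_)
    push_cast; ring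

section Norms

variable {M d : ℕ} [NeZero M]

lemma latticeNorm_eq_norm_toLp {r : ℝ≥0∞} (hr : 2 ≤ r) (f : Lattice M d → ℂ) :
    latticeNorm r f = (mesh M ^ d) ^ (1 / r).toReal * ‖WithLp.toLp r f‖ := by
  have hmesh := mesh_pos M
  by_cases h : r = ∞
  · subst h
    rw [latticeNorm, if_pos rfl, PiLp.norm_eq_ciSup]
    simp
  · have hr0 : 0 < r.toReal := ENNReal.toReal_pos (by rintro rfl; simp at hr) h
    rw [latticeNorm, if_neg h, PiLp.norm_eq_sum hr0, Real.mul_rpow (by positivity)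
      (sum_nonneg fun x _ => by positivity), ENNReal.toReal_div]
    simp

lemma latticeNorm_sum_le {ι : Type*} {r : ℝ≥0∞} (hr : 2 ≤ r) (J : Finset ι)
    (f : ι → Lattice M d → ℂ) : latticeNorm r (∑ j ∈ J, f j) ≤ ∑ j ∈ J, latticeNorm r (f j) := by
  have hmesh := mesh_pos M
  have : Fact (1 ≤ r) := ⟨le_trans (by norm_num) hr⟩
  simp_rw [latticeNorm_eq_norm_toLp hr, ← mul_sum]
  gcongr
  rw [WithLp.toLp_sum]
  exact norm_sum_le _ _

lemma continuous_latticeNorm_propagator {r : ℝ≥0∞} (hr : 2 ≤ r) (u : Lattice M d → ℂ) :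
    Continuous fun t : ℝ => latticeNorm r (propagator M d t u) := by
  have : Fact (1 ≤ r) := ⟨le_trans (by norm_num) hr⟩
  simp_rw [latticeNorm_eq_norm_toLp hr]
  have hu : Continuous fun t : ℝ => propagator M d t u := by
    rw [← trigPoly_coeff u]
    simp_rw [propagator_trigPoly]
    unfold trigPoly
    fun_prop
  exact continuous_const.mul (continuous_norm.comp ((PiLp.continuous_toLp r _).comp hu))

/-- **Frequency-localized Strichartz estimate** on the unit time interval. -/
lemma eLpNorm_propagator_le_of_cube {N : ℕ} (hN : 1 ≤ N) (hNM : N ≤ M) {q r : ℝ≥0∞} (hr : 2 ≤ r)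
    (hq : 2 ≤ q) (hq' : q ≠ ∞) (hqr : d * (1 - (2 / r).toReal) = 6 / q.toReal)
    (c : (Fin d → ℤ) → ℂ) :
    eLpNorm (fun t : ℝ => latticeNorm r (propagator M d t (trigPoly (freqs N d) c))) q
        (volume.restrict (Set.Icc (0 : ℝ) 1)) ≤
      ENNReal.ofReal ((180 ^ 3 * N ^ 2 * (3 + 2 * Real.log N)) ^ (1 / q.toReal) *
        latticeNorm 2 (trigPoly (freqs N d) c : Lattice M d → ℂ)) := by
  have hq2 : 2 ≤ q.toReal := by simpa using ENNReal.toReal_mono hq' hq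
  have hq0 : 0 < q.toReal := by linarith
  have hN' : (1 : ℝ) ≤ N := by exact_mod_cast hN
  have hlog := Real.log_nonneg hN'
  set v : Lattice M d → ℂ := trigPoly (freqs N d) c with hv
  set U := latticeNorm 2 v with hU
  have hU0 : 0 ≤ U := latticeNorm_nonneg _ _
  set φ : ℝ → ℝ := fun t => latticeNorm r (propagator M d t v) ^ q.toReal with hφ
  have hφ0 : ∀ t, 0 ≤ φ t := fun t => Real.rpow_nonneg (latticeNorm_nonneg _ _) _
  have hφc : Continuous φ := (continuous_latticeNorm_propagator hr v).rpow_const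
    fun _ => Or.inr hq0.le
  set K : ℝ := 180 ^ 3 * N ^ 3 * (3 + 2 * Real.log N) * U ^ q.toReal with hK
  have hK0 : 0 ≤ K := by positivity
  set δ : ℝ := 1 / (N : ℝ) ^ 2 with hδ
  have hδ0 : 0 ≤ δ := by positivity
  -- A time interval of length `1 / N` is cut into `N` pieces; the integrand is summed over the
  -- translates of a point of the first piece.
  have hshort : ∀ a : ℝ, ∫⁻ t in Set.Icc 0 (1 / (N : ℝ)), ENNReal.ofReal (φ (a + t)) ≤
      ENNReal.ofReal (δ * K) := by
    intro a
    have h1 : (1 / (N : ℝ)) = N * δ := by rw [hδ]; field_simp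
    rw [h1]
    refine (setLIntegral_Icc_le_sum (fun t => ENNReal.ofReal (φ (a + t))) N hδ0).trans ?_
    rw [← lintegral_finsetSum]
    · have h2 : ∀ s, ∑ j ∈ range N, ENNReal.ofReal (φ (a + (j * δ + s))) ≤ ENNReal.ofReal K := by
        intro s
        rw [← ENNReal.ofReal_sum_of_nonneg fun _ _ => hφ0 _]
        refine ENNReal.ofReal_le_ofReal ?_
        have := sum_latticeNorm_rpow_le hN hNM hr hq2 hqr c (a + s)
        refine le_trans (le_of_eq (sum_congr rfl fun j _ => ?_)) this
        simp only [hφ]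
        congr 4
        ring
      refine (lintegral_mono h2).trans ?_
      rw [setLIntegral_const, Real.volume_Icc, sub_zero, mul_comm, ENNReal.ofReal_mul hδ0]
    · intro j _
      exact ENNReal.measurable_ofReal.comp (hφc.comp (by fun_prop)).measurable
  have htotal : ∫⁻ t in Set.Icc (0 : ℝ) 1, ENNReal.ofReal (φ t) ≤ ENNReal.ofReal (N * (δ * K)) := by
    have h1 : (1 : ℝ) = N * (1 / N) := by field_simp
    calc ∫⁻ t in Set.Icc (0 : ℝ) 1, ENNReal.ofReal (φ t)
        = ∫⁻ t in Set.Icc (0 : ℝ) (N * (1 / N)), ENNReal.ofReal (φ t) := by rw [← h1]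
      _ ≤ _ := setLIntegral_Icc_le_sum _ N (by positivity)
      _ ≤ ∑ _j ∈ range N, ENNReal.ofReal (δ * K) := sum_le_sum fun j _ => hshort _
      _ = _ := by
        rw [sum_const, card_range, nsmul_eq_mul, ENNReal.ofReal_mul (p := (N : ℝ)) (by positivity),
          ENNReal.ofReal_natCast]
  rw [eLpNorm_eq_lintegral_rpow_enorm_toReal (by rintro rfl; simp at hq) hq']
  have h1 : ∀ t, ‖latticeNorm r (propagator M d t v)‖ₑ ^ q.toReal = ENNReal.ofReal (φ t) := by
    intro t
    rw [Real.enorm_of_nonneg (latticeNorm_nonneg _ _),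
      ENNReal.ofReal_rpow_of_nonneg (latticeNorm_nonneg _ _) hq0.le]
  simp_rw [h1]
  refine (ENNReal.rpow_le_rpow htotal (by positivity)).trans (le_of_eq ?_)
  rw [ENNReal.ofReal_rpow_of_nonneg (by positivity) (by positivity)]
  congr 1
  have h2 : N * (δ * K) = (180 ^ 3 * N ^ 2 * (3 + 2 * Real.log N)) * U ^ q.toReal := by
    rw [hδ, hK]; field_simp
  rw [h2, Real.mul_rpow (by positivity) (by positivity), ← Real.rpow_mul hU0,
    mul_one_div_cancel hq0.ne', Real.rpow_one]

end Norms

/-! ### Summation over dyadic shells -/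

section Dyadic

variable {M d : ℕ}

lemma one_le_bracket (k : Fin d → ℤ) : 1 ≤ bracket k := by
  rw [bracket, Real.one_le_sqrt]
  have : 0 ≤ ∑ j, (k j : ℝ) ^ 2 := sum_nonneg fun _ _ => sq_nonneg _
  linarith

lemma abs_lt_bracket (k : Fin d → ℤ) (j : Fin d) : |(k j : ℝ)| < bracket k := by
  rw [bracket]
  refine Real.lt_sqrt_of_sq_lt ?_
  rw [sq_abs]
  have := single_le_sum (f := fun j => (k j : ℝ) ^ 2) (fun _ _ => sq_nonneg _) (mem_univ j)
  linarith

/-- The index `j` of the dyadic shell `2 ^ j ≤ ⟨k⟩ < 2 ^ (j + 1)` of the frequency `k`. -/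
noncomputable def shellIndex (k : Fin d → ℤ) : ℕ := Nat.log 2 ⌊bracket k⌋₊

lemma two_pow_shellIndex_le (k : Fin d → ℤ) : (2 : ℝ) ^ shellIndex k ≤ bracket k := by
  have h := one_le_bracket k
  have h1 : 2 ^ shellIndex k ≤ ⌊bracket k⌋₊ :=
    Nat.pow_log_le_self 2 (Nat.floor_pos.2 h).ne'
  calc (2 : ℝ) ^ shellIndex k ≤ (⌊bracket k⌋₊ : ℝ) := by exact_mod_cast h1
    _ ≤ _ := Nat.floor_le (by linarith)

lemma bracket_lt_two_pow (k : Fin d → ℤ) : bracket k < (2 : ℝ) ^ (shellIndex k + 1) := by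
  have h1 : ⌊bracket k⌋₊ < 2 ^ (shellIndex k + 1) := Nat.lt_pow_succ_log_self (by norm_num) _
  have := Nat.lt_of_floor_lt h1
  exact_mod_cast this

/-- The Fourier coefficients of `c` in the `j`-th dyadic shell. -/
noncomputable def shellCoeff (c : (Fin d → ℤ) → ℂ) (j : ℕ) (k : Fin d → ℤ) : ℂ :=
  if shellIndex k = j then c k else 0

/-- The `j`-th dyadic shell of the dual lattice lies in the cube of half side
`min (2 ^ (j + 1)) M`. -/
lemma trigPoly_shellCoeff (c : (Fin d → ℤ) → ℂ) (j : ℕ) :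
    (trigPoly (freqs M d) (shellCoeff c j) : Lattice M d → ℂ) =
      trigPoly (freqs (min (2 ^ (j + 1)) M) d) (shellCoeff c j) := by
  funext x
  rw [trigPoly, trigPoly]
  symm
  refine sum_subset (freqs_mono (min_le_right _ _) d) fun k hk hk' => ?_
  rw [shellCoeff, if_neg, zero_mul]
  rintro rfl
  refine hk' ?_
  rw [freqs, Fintype.mem_piFinset] at hk ⊢
  intro i
  have h1 := (abs_lt_bracket k i).trans (bracket_lt_two_pow k)
  have h2 : |k i| < 2 ^ (shellIndex k + 1) := by exact_mod_cast h1
  rw [abs_lt] at h2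
  have h3 := hk i
  rw [mem_Ico] at h3 ⊢
  push_cast
  rw [← max_neg_neg]
  exact ⟨max_le h2.1.le h3.1, lt_min h2.2 h3.2⟩

lemma sum_trigPoly_shellCoeff (c : (Fin d → ℤ) → ℂ) :
    ∃ J, ∑ j ∈ range J, (trigPoly (freqs M d) (shellCoeff c j) : Lattice M d → ℂ) =
      trigPoly (freqs M d) c := by
  refine ⟨(freqs M d).sup shellIndex + 1, ?_⟩
  funext x
  simp only [Finset.sum_apply, trigPoly]
  rw [sum_comm]
  refine sum_congr rfl fun k hk => ?_
  rw [← sum_mul]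
  congr 1
  simp only [shellCoeff]
  rw [sum_ite_eq, if_pos]
  exact mem_range.2 (Nat.lt_succ_of_le (le_sup hk))

variable [NeZero M]

/-- On the `j`-th shell, `⟨∇_h⟩^s` gains the factor `2 ^ (j s)`. -/
lemma latticeNorm_shell_le {s : ℝ} (hs : 0 ≤ s) (u : Lattice M d → ℂ) (j : ℕ) :
    latticeNorm 2 (trigPoly (freqs M d) (shellCoeff (coeff u) j) : Lattice M d → ℂ) ≤
      ((2 : ℝ) ^ (-s)) ^ j * latticeNorm 2 (fracDeriv s u) := by
  rw [fracDeriv_eq_trigPoly, latticeNorm_two_trigPoly subset_rfl,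
    latticeNorm_two_trigPoly subset_rfl]
  set a : ℝ := ((2 : ℝ) ^ (-s)) ^ j with ha
  have ha0 : 0 < a := by positivity
  rw [← Real.sqrt_sq ha0.le, ← Real.sqrt_mul (sq_nonneg a)]
  refine Real.sqrt_le_sqrt ?_
  rw [mul_left_comm, mul_sum _ _ (a ^ 2)]
  have hpi : 0 ≤ (2 * Real.pi) ^ d := by positivity
  refine mul_le_mul_of_nonneg_left (sum_le_sum fun k _ => ?_) hpi
  rw [shellCoeff]
  split_ifs with h
  · have hb := one_le_bracket k
    have h1 : 1 ≤ a * bracket k ^ s := by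
      have h2 : ((2 : ℝ) ^ s) ^ j ≤ bracket k ^ s := by
        rw [← Real.rpow_natCast, ← Real.rpow_mul (by norm_num), mul_comm s,
          Real.rpow_mul (by norm_num), Real.rpow_natCast, ← h]
        exact Real.rpow_le_rpow (by positivity) (two_pow_shellIndex_le k) hs
      calc 1 = a * ((2 : ℝ) ^ s) ^ j := by
            rw [ha, ← mul_pow, ← Real.rpow_add (by norm_num)]; simp
        _ ≤ _ := by gcongr
    rw [norm_mul, Complex.norm_real, Real.norm_of_nonneg (by positivity), ← mul_pow, ← mul_assoc]
    have hc := norm_nonneg (coeff u k)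
    gcongr
    nlinarith
  · rw [norm_zero, zero_pow two_ne_zero]
    positivity

end Dyadic

end PeriodicLattice

open PeriodicLattice in
theorem theorem1p1 (d : ℕ) (hd : 1 ≤ d) (q r : ℝ≥0∞) (hqr : LatticeAdmissible d q r)
    (ε : ℝ) (hε : 0 < ε) :
    ∃ C : ℝ, 0 < C ∧ ∀ (M : ℕ) [NeZero M], mesh M ≤ 1 → ∀ u : Lattice M d → ℂ,
      eLpNorm (fun t : ℝ => latticeNorm r (propagator M d t u)) q
          (volume.restrict (Set.Icc (0 : ℝ) 1))
        ≤ ENNReal.ofReal (C * latticeNorm 2 (fracDeriv ((2 / q).toReal + ε) u)) := by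
  obtain ⟨hq, hr, hadm, -⟩ := hqr
  have hq0 : q ≠ 0 := by rintro rfl; simp at hq
  have hr0 : r ≠ 0 := by rintro rfl; simp at hr
  have hreal : 3 / q.toReal + d * (1 / r.toReal) = d / 2 := by
    have h := congrArg ENNReal.toReal hadm
    rw [ENNReal.toReal_add (ENNReal.div_ne_top (by simp) hq0) (ENNReal.div_ne_top (by simp) hr0),
      ENNReal.toReal_div, ENNReal.toReal_div, ENNReal.toReal_div] at h
    simp only [ENNReal.toReal_ofNat, ENNReal.toReal_natCast] at h
    rw [← h]; ring
  have hs0 : 0 ≤ (2 / q).toReal := ENNReal.toReal_nonneg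
  set s : ℝ := (2 / q).toReal + ε with hs
  by_cases hq' : q = ∞
  · -- Here `r = 2`, and the propagator is unitary.
    have hr2 : r = 2 := by
      rw [hq', ENNReal.toReal_top, div_zero, zero_add] at hreal
      have hd' : (d : ℝ) ≠ 0 := by positivity
      have h1 : 1 / r.toReal = 1 / 2 := mul_left_cancel₀ hd' (by rw [hreal]; ring)
      have h2 : r.toReal = 2 := by simpa using h1
      rw [← ENNReal.ofReal_toReal (a := r) (by rintro rfl; simp at h2), h2]
      simp
    refine ⟨1, one_pos, fun M _ _ u => ?_⟩
    rw [hq', hr2, eLpNorm_exponent_top]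
    refine eLpNormEssSup_le_of_ae_bound (Filter.Eventually.of_forall fun t => ?_)
    rw [Real.norm_of_nonneg (latticeNorm_nonneg _ _), one_mul, fracDeriv_eq_trigPoly]
    conv_lhs => rw [← trigPoly_coeff u, propagator_trigPoly]
    rw [latticeNorm_two_trigPoly subset_rfl, latticeNorm_two_trigPoly subset_rfl]
    refine Real.sqrt_le_sqrt (mul_le_mul_of_nonneg_left (Finset.sum_le_sum fun k _ => ?_)
      (by positivity))
    have h1 : Complex.exp (-(Complex.I * ((t * symbol M k : ℝ) : ℂ))) =
        Complex.exp (((-(t * symbol M k) : ℝ) : ℂ) * Complex.I) := by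
      congr 1; push_cast; ring
    have hb := one_le_bracket k
    have hbs : 1 ≤ bracket k ^ s := Real.one_le_rpow hb (by positivity)
    rw [norm_mul, norm_mul, h1, Complex.norm_exp_ofReal_mul_I, mul_one, Complex.norm_real,
      Real.norm_of_nonneg (by positivity)]
    gcongr
    exact le_mul_of_one_le_left (norm_nonneg _) hbs
  · have hq2 : 2 ≤ q.toReal := by simpa using ENNReal.toReal_mono hq' hq
    have hqpos : 0 < q.toReal := by linarith
    have hs' : s = 2 / q.toReal + ε := by
      rw [hs, ENNReal.toReal_div, ENNReal.toReal_ofNat]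
    have hexp : d * (1 - (2 / r).toReal) = 6 / q.toReal := by
      rw [ENNReal.toReal_div, ENNReal.toReal_ofNat]
      linear_combination (-2) * hreal
    set ρ : ℝ := (2 : ℝ) ^ (-ε) with hρ
    have hρ0 : 0 < ρ := by positivity
    have hρ1 : ρ < 1 := Real.rpow_lt_one_of_one_lt_of_neg (by norm_num) (by linarith)
    have hsummable : Summable fun j : ℕ => (5 + 2 * (j : ℝ)) * ρ ^ j := by
      have h1 := summable_geometric_of_lt_one hρ0.le hρ1
      have h2 := summable_pow_mul_geometric_of_norm_lt_one 1
        (show ‖ρ‖ < 1 by rwa [Real.norm_of_nonneg hρ0.le])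
      refine ((h1.mul_left 5).add (h2.mul_left 2)).congr fun j => ?_
      rw [pow_one]; ring
    set T : ℝ := ∑' j : ℕ, (5 + 2 * (j : ℝ)) * ρ ^ j with hT
    have hT0 : 0 < T := hsummable.tsum_pos (fun j => by positivity) 0 (by positivity)
    refine ⟨180 ^ 3 * 4 * T, by positivity, fun M _ _ u => ?_⟩
    set W : ℝ := latticeNorm 2 (fracDeriv s u) with hW
    have hW0 : 0 ≤ W := latticeNorm_nonneg _ _
    obtain ⟨J, hJ⟩ := sum_trigPoly_shellCoeff (M := M) (coeff u)
    set v : ℕ → Lattice M d → ℂ := fun j => trigPoly (freqs M d) (shellCoeff (coeff u) j) with hv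
    have hu : u = ∑ j ∈ Finset.range J, v j := by
      rw [hJ, trigPoly_coeff]
    have hpiece : ∀ j, eLpNorm (fun t : ℝ => latticeNorm r (propagator M d t (v j))) q
        (volume.restrict (Set.Icc (0 : ℝ) 1)) ≤
          ENNReal.ofReal (180 ^ 3 * 4 * W * ((5 + 2 * (j : ℝ)) * ρ ^ j)) := by
      intro j
      set N : ℕ := min (2 ^ (j + 1)) M with hN
      have hN1 : 1 ≤ N := le_min Nat.one_le_two_pow (Nat.pos_of_ne_zero (NeZero.ne M))
      have hN1' : (1 : ℝ) ≤ N := by exact_mod_cast hN1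
      have hN2 : (N : ℝ) ≤ 2 ^ (j + 1) := by
        have : N ≤ 2 ^ (j + 1) := min_le_left _ _
        exact_mod_cast this
      have hlog0 := Real.log_nonneg hN1'
      have hlog : Real.log N ≤ j + 1 := by
        calc Real.log N ≤ Real.log (2 ^ (j + 1)) := Real.log_le_log (by linarith) hN2
          _ = (j + 1) * Real.log 2 := by rw [Real.log_pow]; push_cast; ring
          _ ≤ (j + 1) * 1 := by
            have := Real.log_two_lt_d9
            gcongr
            linarith
          _ = _ := mul_one _
      have h1 := eLpNorm_propagator_le_of_cube hN1 (min_le_right _ _) hr hq hq' hexp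
        (shellCoeff (coeff u) j) (M := M)
      rw [← trigPoly_shellCoeff (coeff u) j] at h1
      refine h1.trans (ENNReal.ofReal_le_ofReal ?_)
      have h2 := latticeNorm_shell_le (s := s) (by positivity) u j
      have hq1 : 1 / q.toReal ≤ 1 := by rw [div_le_one hqpos]; linarith
      have h3 : (180 ^ 3 * (N : ℝ) ^ 2 * (3 + 2 * Real.log N)) ^ (1 / q.toReal) ≤
          180 ^ 3 * 4 * (5 + 2 * (j : ℝ)) * ((2 : ℝ) ^ (2 / q.toReal)) ^ j := by
        calc _ ≤ (180 ^ 3 * ((2 : ℝ) ^ (j + 1)) ^ 2 * (3 + 2 * (j + 1))) ^ (1 / q.toReal) := by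
              gcongr
          _ = (180 ^ 3 * 4 * (5 + 2 * (j : ℝ)) * (2 ^ (2 : ℝ)) ^ (j : ℝ)) ^ (1 / q.toReal) := by
              congr 1
              rw [Real.rpow_natCast]
              norm_num
              rw [← pow_mul, mul_comm (j + 1) 2, pow_mul, pow_succ]
              norm_num
              ring
          _ = (180 ^ 3 * 4 * (5 + 2 * (j : ℝ))) ^ (1 / q.toReal) *
              ((2 : ℝ) ^ (2 / q.toReal)) ^ j := by
              rw [Real.mul_rpow (by positivity) (by positivity),
                ← Real.rpow_natCast ((2 : ℝ) ^ (2 / q.toReal)), ← Real.rpow_mul (by norm_num),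
                ← Real.rpow_mul (by norm_num),
                ← Real.rpow_mul (by norm_num)]
              congr 2
              ring
          _ ≤ (180 ^ 3 * 4 * (5 + 2 * (j : ℝ))) ^ (1 : ℝ) * ((2 : ℝ) ^ (2 / q.toReal)) ^ j := by
              have : (0 : ℝ) ≤ j := by positivity
              gcongr
              linarith
          _ = _ := by rw [Real.rpow_one]
      have h4 : ((2 : ℝ) ^ (2 / q.toReal)) ^ j * ((2 : ℝ) ^ (-s)) ^ j = ρ ^ j := by
        rw [← mul_pow, ← Real.rpow_add (by norm_num), hρ, hs']
        congr 2
        ring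
      calc _ ≤ 180 ^ 3 * 4 * (5 + 2 * (j : ℝ)) * ((2 : ℝ) ^ (2 / q.toReal)) ^ j *
            (((2 : ℝ) ^ (-s)) ^ j * W) := by
            refine mul_le_mul h3 h2 (latticeNorm_nonneg _ _) (by positivity)
        _ = 180 ^ 3 * 4 * W * ((5 + 2 * (j : ℝ)) * ρ ^ j) := by rw [← h4]; ring
    calc eLpNorm (fun t : ℝ => latticeNorm r (propagator M d t u)) q
          (volume.restrict (Set.Icc (0 : ℝ) 1))
        ≤ eLpNorm (∑ j ∈ Finset.range J, fun t : ℝ => latticeNorm r (propagator M d t (v j))) q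
          (volume.restrict (Set.Icc (0 : ℝ) 1)) := by
          refine eLpNorm_mono_real fun t => ?_
          rw [Real.norm_of_nonneg (latticeNorm_nonneg _ _), hu, map_sum, Finset.sum_apply]
          exact latticeNorm_sum_le hr _ _
      _ ≤ ∑ j ∈ Finset.range J, eLpNorm (fun t : ℝ => latticeNorm r (propagator M d t (v j))) q
          (volume.restrict (Set.Icc (0 : ℝ) 1)) :=
          eLpNorm_sum_le (fun j _ => (continuous_latticeNorm_propagator hr _).aestronglyMeasurable)
            (le_trans (by norm_num) hq)
      _ ≤ ∑ j ∈ Finset.range J, ENNReal.ofReal (180 ^ 3 * 4 * W * ((5 + 2 * (j : ℝ)) * ρ ^ j)) :=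
          Finset.sum_le_sum fun j _ => hpiece j
      _ = ENNReal.ofReal (180 ^ 3 * 4 * W * ∑ j ∈ Finset.range J, (5 + 2 * (j : ℝ)) * ρ ^ j) := by
          rw [← ENNReal.ofReal_sum_of_nonneg fun j _ => by positivity, Finset.mul_sum]
      _ ≤ ENNReal.ofReal (180 ^ 3 * 4 * T * W) := by
          refine ENNReal.ofReal_le_ofReal ?_
          have := hsummable.sum_le_tsum (Finset.range J) fun j _ => by positivity
          calc _ ≤ 180 ^ 3 * 4 * W * T := by gcongr
            _ = _ := by ring
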